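/- **Setting.** A cost problem $\mathcal P$ has request sets $E_t$ (each with a metric $d$), measurable nonempty action sets $A_t$, and costs $R_t(e_{1:t},a_{1:t})\in[0,L]$, measurable in the actions, for $t\ge 1$. For a history $\mathcal I=(e_{1:m-1},a_{1:m-1})$ and $n\in\mathbb Z_+\cup\{\infty\}$, $\mathrm{Val}(\mathcal P^{\mathcal I},e_{m:n},a_{m:n})=\sum_{t=m}^{n}R_t(e_{1:t},a_{1:t})$ and $\mathrm{Opt}(\mathcal P^{\mathcal I},e_{m:n})=\inf_{a_{m:n}}\mathrm{Val}(\mathcal P^{\mathcal I},e_{m:n},a_{m:n})$; for a (randomized) policy, $\mathrm{Val}$ is the expected cost. The effective length $M(e_{1:\infty})$ is the least $M$ with $R_t(e_{1:t},a_{1:t})=0$ for all $t>M$ and all $a$; $e_{1:\infty}$ is finite if $M(\hat e_{1:n}\circ e_{n+1:\infty})<\infty$ for all $n$ and $\hat e_{1:n}$. All request sequences below are (parts of) finite ones. * $\mathcal P$ is *$f$-bounded-influence* if $|\mathrm{Opt}(\mathcal P^{\mathcal I},e_{m:n})-\mathrm{Opt}(\mathcal P^{\mathcal I'},e_{m:n})|\le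 fL$ for all $m\le n\le\infty$, all histories $\mathcal I,\mathcal I'$ of length $m-1$ and all $e_{m:n}$. * $\mathcal P$ is *$(u,v)$-strongly-Lipschitz* if changing the single request $e_m$ to $e_m'$ changes $\mathrm{Val}(\mathcal P^{\mathcal I},e_{m:n},a_{m:n})$ by at most $L\min(u\,d(e_m,e'_m),v)$, for all $m\le n<\infty$, $\mathcal I$, $e_{m:n}$, $e_m'$, $a_{m:n}$. * A *$\gamma$-offline oracle* returns, for all $m\le n\le\infty$, $\mathcal I$, $e_{m:n}$, actions with $\mathrm{Val}(\mathcal P^{\mathcal I},e_{m:n},a_{m:n})\le\gamma\,\mathrm{Opt}(\mathcal P^{\mathcal I},e_{m:n})$ (measurably in the past actions). * An *$\eta$-online oracle* is a family of randomized online policies $\pi_m$, $m\ge0$ ($\pi_m$ is started after $m$ periods), with $\mathrm{Val}(\mathcal P,e_{1:n},\pi_0)\le\eta\,\mathrm{Opt}(\mathcal P,e_{1:n})$ and, for $m\ge1$, $\mathrm{Val}(\mathcal P^{\mathcal I},e_{m+1:m+n},\pi_m)\le\eta\,(\mathrm{Opt}(\mathcal P^{\mathcal I},e_{m+1:m+n})+fL)$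 for every history $\mathcal I$ of length $m$. * An *effective length estimator* returns $\mathrm{EstimateM}(e_{1:i},e^*_{1:\infty})\in\mathbb Z_{\ge0}$ with $\mathrm{EstimateM}(e_{1:i},e^*_{1:\infty})\ge M(e_{1:i}\circ e^*_{i+1:\infty})$. **AdaSwitch (cost minimization).** Input: a prediction $e^*_{1:\infty}$, the two oracles, an estimator, $\epsilon,\alpha,b,c>0$ and an integer $H\ge1$. Start in the *conservative* state with $\tau=1$. In period $t$, observe $e_t$. *Conservative:* execute $a_t$ drawn from $\pi_{\tau-1}$. Let $s$ be the average cost of $H t^5$ independent fresh simulations of $\pi_{\tau-1}$ on $e_{\tau:t}$ from the history $(e_{1:\tau-1},a_{1:\tau-1})$, and let $u'$ be the cost of the offline oracle's solution for $e_{\tau:t}$ from that history. If $s\ge\frac{18\eta}{\epsilon}(\eta+\epsilon)\gamma\alpha cL$ and $u'\ge\gamma$, become *predictive*, set $\tau_p=t+1$ and $\varphi=0$. *Predictive:* if $t=\tau_p$, compute a new batch: while $\tau_p\le\mathrm{EstimateM}(e_{1:t},e^*)$ and $\mathrm{Val}(\mathcal P^{\mathcal I(t)},e_t\circ e^*_{t+1:\tau_p-1},a_{t:\tau_p-1})<\alpha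 cL$, where $\mathcal I(t)=(e_{1:t-1},a_{1:t-1})$, replace $a_{t:\tau_p}$ by the offline oracle's solution for $e_t\circ e^*_{t+1:\tau_p}$ from $\mathcal I(t)$ and increase $\tau_p$ by one. If afterwards this value is still below $\alpha cL$, extend $a_{t:\tau_p-1}$ by arbitrary actions to $a_{t:\infty}$ and set $\tau_p=\infty$. Execute $a_t$ of the current batch and add $\min(d(e_t,e_t^*),c/b)$ to $\varphi$; if $\varphi\ge 5(\eta+\epsilon)\alpha c/b$, become conservative with $\tau=t+1$. **Theorem.** Let $\mathcal P$ be $(u,v)$-strongly-Lipschitz and $f$-bounded-influence, $\gamma,\eta\ge1$, $\epsilon>0$, $b=u$, $c=\max(v,f)$ with $c\ge b\ge1$, and $\alpha\ge\max(16\gamma,\gamma+2\gamma^2/\epsilon)$. Let $e_{1:\infty}$ and $e^*_{1:\infty}$ be finite request sequences that differ in only finitely many periods, with $\mathrm{Opt}:=\mathrm{Opt}(\mathcal P,e_{1:\infty})\ne0$. Put $\varphi^*=\sum_{j\ge1}\min(d(e_j,e_j^*),c/b)$ and let $\mathrm{Comp}$ be the expected total cost of AdaSwitch (with any $\gamma$-offline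 oracle, $\eta$-online oracle, estimator and $H\ge1$) divided by $\mathrm{Opt}$. Then $\varphi^*\le\sum_{j\ge1}d(e_j,e_j^*)$ and 1. if $\gamma+\frac{\gamma^2}{\alpha-\gamma}\le\eta+\epsilon$ (in particular, if $\gamma\le\eta$), then $\mathrm{Comp}\le\eta+\epsilon$; 2. if $cL\ge1$, then $$\mathrm{Comp}\le\gamma+\frac{\gamma^2}{\alpha-\gamma}+\frac{L}{\epsilon\,\mathrm{Opt}}\Bigl(19\gamma\alpha\eta(\eta+\epsilon)c+(4\eta+3\epsilon)\gamma b\varphi^*\Bigr).$$ Hence $\mathrm{Comp}$ is at most the minimum of the two bounds when both conditions hold. -/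

import Mathlib

open MeasureTheory ProbabilityTheory

namespace AdaSwitch

/-! Periods are numbered from `0`: the index `t` stands for the `(t+1)`-st period. A trajectory is a
full sequence `x : ∀ i, X i`; `pre x n` is its prefix of length `n`. The segment of the periods
`m, …, n-1` is described by its two endpoints `m` (the length of the fixed history) and `n`
(possibly `⊤`). -/

/-- Prefixes of length `n`. -/
abbrev Pre (X : ℕ → Type*) (n : ℕ) := ∀ i : Fin n, X i

/-- The prefix of length `n` of a sequence. -/
def pre {X : ℕ → Type*} (x : ∀ i, X i) (n : ℕ) : Pre X n := fun i => x i

/-- The first `m` entries of `x` followed by the entries of `y` from index `m` on. -/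
def splice {X : ℕ → Type*} (m : ℕ) (x y : ∀ i, X i) : ∀ i, X i :=
  fun i => if i < m then x i else y i

section Measurability

variable {A : ℕ → Type*} [∀ t, MeasurableSpace (A t)]

theorem measurable_pre (n : ℕ) : Measurable fun x : (∀ i, A i) => pre x n :=
  measurable_pi_iff.2 fun i => measurable_pi_apply (i : ℕ)

theorem measurable_splice (m : ℕ) :
    Measurable fun p : (∀ i, A i) × (∀ i, A i) => splice m p.1 p.2 := by
  refine measurable_pi_iff.2 fun i => ?_
  by_cases h : i < m
  · simp only [splice, h, if_true]
    exact (measurable_pi_apply i).comp measurable_fst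
  · simp only [splice, h, if_false]
    exact (measurable_pi_apply i).comp measurable_snd

theorem measurable_write (t : ℕ) :
    Measurable fun p : (∀ i, A i) × A t => Function.update p.1 t p.2 :=
  measurable_update'

end Measurability

/-- A multi-period decision problem with request sets `E t`, action sets `A t` and costs in `[0, L]`
that depend on the requests and actions up to the current period. -/
structure CostProblem (E A : ℕ → Type*) [∀ t, MeasurableSpace (A t)] where
  L : ℝ
  cost : ∀ t : ℕ, Pre E (t + 1) → Pre A (t + 1) → ℝ
  cost_mem : ∀ t e a, cost t e a ∈ Set.Icc 0 L
  measurable_cost : ∀ t e, Measurable (cost t e)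

namespace CostProblem

variable {E A : ℕ → Type*} [∀ t, MeasurableSpace (A t)] (P : CostProblem E A)

/-- The cost of period `t` along a trajectory. -/
def costAt (t : ℕ) (e : ∀ i, E i) (a : ∀ i, A i) : ℝ := P.cost t (pre e (t + 1)) (pre a (t + 1))

/-- The cumulative cost of the periods `m, …, n-1` (all periods from `m` on if `n = ⊤`), in the
partial problem whose history is given by the first `m` entries of `e` and `a`. -/
noncomputable def val (m : ℕ) (n : ℕ∞) (e : ∀ i, E i) (a : ∀ i, A i) : ℝ :=
  ∑' t : ℕ, if m ≤ t ∧ (t : ℕ∞) < n then P.costAt t e a else 0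

/-- The hindsight optimum over the periods `m, …, n-1`, given the history formed by the first `m`
entries of `e` and `a`. -/
noncomputable def opt (m : ℕ) (n : ℕ∞) (e : ∀ i, E i) (a : ∀ i, A i) : ℝ :=
  ⨅ a' : ∀ i, A i, P.val m n e (splice m a a')

/-- The hindsight optimum of the whole problem. -/
noncomputable def totalOpt (e : ∀ i, E i) : ℝ := ⨅ a : ∀ i, A i, P.val 0 ⊤ e a

/-- The effective length: the least number of periods after which all costs vanish. -/
noncomputable def effLen (e : ∀ i, E i) : ℕ∞ :=
  sInf {M : ℕ∞ | ∀ t : ℕ, M ≤ t → ∀ a : ∀ i, A i, P.costAt t e a = 0}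

/-- Finite request sequences: the effective length is finite whatever prefix is substituted. -/
def IsFinite (e : ∀ i, E i) : Prop := ∀ (n : ℕ) (e' : ∀ i, E i), P.effLen (splice n e' e) < ⊤

/-- `f`-bounded influence: replacing the history before period `m` changes the hindsight optimum
of the remaining requests by at most `f * L`. -/
def BoundedInfluence (f : ℝ) : Prop :=
  ∀ (m : ℕ) (n : ℕ∞) (e e' : ∀ i, E i) (a a' : ∀ i, A i), (m : ℕ∞) < n → P.IsFinite e →
    |P.opt m n e a - P.opt m n (splice m e' e) a'| ≤ f * P.L

/-- `(u, v)`-strong Lipschitz continuity: changing the single request `e m` to `x`. -/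
def StronglyLipschitz [∀ t, MetricSpace (E t)] (u v : ℝ) : Prop :=
  ∀ (m n : ℕ) (e : ∀ i, E i) (x : E m) (a : ∀ i, A i), m < n → P.IsFinite e →
    |P.val m n e a - P.val m n (Function.update e m x) a| ≤ P.L * min (u * dist (e m) x) v

theorem val_coe (m n : ℕ) (e : ∀ i, E i) (a : ∀ i, A i) :
    P.val m n e a = ∑ t ∈ Finset.Ico m n, P.costAt t e a := by
  rw [val, tsum_eq_sum (s := Finset.Ico m n)]
  · refine Finset.sum_congr rfl fun t ht => ?_
    rw [if_pos]
    simpa using ht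
  · intro t ht
    rw [if_neg]
    simpa using ht

theorem measurable_costAt (t : ℕ) (e : ∀ i, E i) : Measurable (P.costAt t e) :=
  (P.measurable_cost t _).comp (measurable_pre _)

theorem measurable_val (m n : ℕ) (e : ∀ i, E i) : Measurable (P.val m n e) := by
  have : P.val m n e = fun a => ∑ t ∈ Finset.Ico m n, P.costAt t e a :=
    funext fun a => P.val_coe m n e a
  rw [this]
  exact Finset.measurable_sum _ fun t _ => P.measurable_costAt t e

end CostProblem

variable {E A : ℕ → Type*} [∀ t, MeasurableSpace (A t)]

/-- A class of randomized online policies `π m = (π m t)_{t ≥ m}`: the policy `π m`, started after a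
history of length `m`, draws the action of period `t` from a distribution that depends on the
requests up to period `t` and on the actions before period `t`. -/
structure PolicyClass (E A : ℕ → Type*) [∀ t, MeasurableSpace (A t)] where
  pol : ∀ (_ t : ℕ), Pre E (t + 1) → Kernel (Pre A t) (A t)
  markov : ∀ m t e, IsMarkovKernel (pol m t e)

namespace PolicyClass

variable (π : PolicyClass E A) (e : ∀ i, E i)

/-- The distribution of the action of period `t` under policy `m`, given the past actions. -/
noncomputable def act (m t : ℕ) : Kernel (∀ i, A i) (A t) :=
  (π.pol m t (pre e (t + 1))).comap (fun x => pre x t) (measurable_pre t)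

instance (m t : ℕ) : IsMarkovKernel (π.act e m t) := by
  have := π.markov m t (pre e (t + 1))
  unfold act
  infer_instance

/-- The trajectory after the policy `m` has chosen the actions of the `k` periods
`m, …, m+k-1`, starting from the history formed by the first `m` actions of the input. (Entries from
`m + k` on are those of the input and play no role.) -/
noncomputable def rollout (m : ℕ) : ℕ → Kernel (∀ i, A i) (∀ i, A i)
  | 0 => Kernel.id
  | k + 1 => ((Kernel.id ×ₖ π.act e m (m + k)).map
      (fun p => Function.update p.1 (m + k) p.2)) ∘ₖ rollout m k

instance (m k : ℕ) : IsMarkovKernel (π.rollout e m k) := by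
  induction k with
  | zero => unfold rollout; infer_instance
  | succ k ih =>
    have := Kernel.IsMarkovKernel.map (Kernel.id ×ₖ π.act e m (m + k)) (measurable_write (m + k))
    unfold rollout
    infer_instance

/-- The expected cumulative cost of the policy `m` over the periods `m, …, n-1`, given the history
formed by the first `m` entries of `e` and `a`. -/
noncomputable def val (P : CostProblem E A) (m : ℕ) (n : ℕ∞) (a : ∀ i, A i) : ℝ :=
  ∑' t : ℕ, if m ≤ t ∧ (t : ℕ∞) < n then
    ∫ x, P.costAt t e x ∂(π.rollout e m (t + 1 - m) a) else 0

end PolicyClass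

/-- An `η`-online oracle for cost minimization. -/
structure OnlineOracle (P : CostProblem E A) (η f : ℝ) extends PolicyClass E A where
  le_zero : ∀ (n : ℕ∞) (e : ∀ i, E i) (a : ∀ i, A i), 0 < n → P.IsFinite e →
    toPolicyClass.val e P 0 n a ≤ η * P.opt 0 n e a
  le_pos : ∀ (m : ℕ) (n : ℕ∞) (e : ∀ i, E i) (a : ∀ i, A i), 0 < m → (m : ℕ∞) < n →
    P.IsFinite e → toPolicyClass.val e P m n a ≤ η * (P.opt m n e a + f * P.L)

/-- A `γ`-offline oracle for cost minimization. The entries `m, …, n-1` of `solve m n e h` are its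
solution for the requests of the periods `m, …, n-1`, given the past requests and the past actions
`h`; the other entries are arbitrary. `solveInf` is the same with an infinite horizon. -/
structure OfflineOracle (P : CostProblem E A) (γ : ℝ) where
  solve : ∀ m n : ℕ, Pre E n → Pre A m → ∀ i, A i
  solveInf : ∀ m : ℕ, (∀ i, E i) → Pre A m → ∀ i, A i
  measurable_solve : ∀ m n e, Measurable (solve m n e)
  le : ∀ (m n : ℕ) (e : ∀ i, E i) (a : ∀ i, A i), m < n → P.IsFinite e →
    P.val m n e (splice m a (solve m n (pre e n) (pre a m))) ≤ γ * P.opt m n e a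
  le_inf : ∀ (m : ℕ) (e : ∀ i, E i) (a : ∀ i, A i), P.IsFinite e →
    P.val m ⊤ e (splice m a (solveInf m e (pre a m))) ≤ γ * P.opt m ⊤ e a

/-- An effective length estimator: an upper bound, computed from the observed requests and the
prediction, of the effective length of the observed requests continued by the prediction. -/
structure LengthEstimator (P : CostProblem E A) where
  est : ∀ k : ℕ, Pre E k → (∀ i, E i) → ℕ
  le_est : ∀ (k : ℕ) (e eStar : ∀ i, E i), P.IsFinite eStar →
    P.effLen (splice k e eStar) ≤ est k (pre e k) eStar

/-- The law of the sum of `N` independent samples of a real random variable with law `κ x`. -/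
noncomputable def sumLaw {α : Type*} [MeasurableSpace α] (κ : Kernel α ℝ) : ℕ → Kernel α ℝ
  | 0 => Kernel.const α (Measure.dirac 0)
  | N + 1 => (sumLaw κ N ×ₖ κ).map (fun p => p.1 + p.2)

instance {α : Type*} [MeasurableSpace α] (κ : Kernel α ℝ) [IsMarkovKernel κ] (N : ℕ) :
    IsMarkovKernel (sumLaw κ N) := by
  induction N with
  | zero => unfold sumLaw; infer_instance
  | succ N ih =>
    unfold sumLaw
    exact Kernel.IsMarkovKernel.map _ (measurable_fst.add measurable_snd)

/-- The discrete memory of the algorithm. `conservative τ`: the conservative state, entered at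
period `τ`. `predictive σ τp`: the predictive state, entered at period `σ`, whose current batch ends
right before period `τp`. -/
inductive Mode where
  | conservative (τ : ℕ)
  | predictive (σ : ℕ) (τp : ℕ∞)

instance : MeasurableSpace Mode := ⊤

instance : DiscreteMeasurableSpace Mode := ⟨fun _ => trivial⟩

instance : Countable Mode := by
  let g : Mode → ℕ ⊕ (ℕ × ℕ∞) := fun z => match z with
    | .conservative τ => .inl τ
    | .predictive σ τp => .inr (σ, τp)
  refine Function.Injective.countable (f := g) ?_
  rintro (a | ⟨a, b⟩) (a' | ⟨a', b'⟩) h <;> simp_all [g]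

/-- The state of the algorithm: its mode, the action sequence computed for the current batch, and
the actions executed so far (the entries from the current period on play no role). -/
abbrev State (A : ℕ → Type*) := Mode × (∀ i, A i) × (∀ i, A i)

/-- The oracles and the input of AdaSwitch: a prediction, the slackness parameter `ε`, the threshold
parameters `α`, `b`, `c`, and the multiplier `H` of the number of Monte Carlo samples. -/
structure Input (P : CostProblem E A) (γ η f : ℝ) where
  offline : OfflineOracle P γ
  online : OnlineOracle P η f
  estimator : LengthEstimator P
  eStar : ∀ i, E i
  ε : ℝ
  α : ℝ
  b : ℝ
  c : ℝ
  H : ℕ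

namespace Input

variable {P : CostProblem E A} {γ η f : ℝ} (S : Input P γ η f)
  (e : ∀ i, E i)

/-- The offline oracle's action sequence for the periods `m, …, n-1`, after the history formed by
the first `m` entries of `e` and `x`. -/
def offlineSeq (m n : ℕ) (e : ∀ i, E i) (x : ∀ i, A i) : ∀ i, A i :=
  splice m x (S.offline.solve m n (pre e n) (pre x m))

/-- Monte Carlo estimate, made in period `t`, of the expected cost over the periods `τ, …, t` of the
online oracle started after the first `τ` actions: the average of `H * (t+1)^5` independent simulated
runs. -/
noncomputable def monteCarlo (τ t : ℕ) : Kernel (∀ i, A i) ℝ :=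
  (sumLaw ((S.online.rollout e τ (t + 1 - τ)).map (P.val τ (t + 1 : ℕ) e)) (S.H * (t + 1) ^ 5)).map
    (fun r => r / (S.H * (t + 1) ^ 5 : ℕ))

/-- The offline oracle's estimate, made in period `t`, of the optimal cost over the periods
`τ, …, t`. -/
noncomputable def optEstimate (τ t : ℕ) (x : ∀ i, A i) : ℝ :=
  P.val τ (t + 1 : ℕ) e (S.offlineSeq τ (t + 1) e x)

open Classical in
/-- The update in a conservative period `t`: `p.1` holds the stored batch and the past actions,
`p.2.1` is the sampled action and `p.2.2` the Monte Carlo estimate. -/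
noncomputable def conservativeUpdate (τ t : ℕ)
    (p : ((∀ i, A i) × (∀ i, A i)) × (A t × ℝ)) : State A :=
  (if 18 * η / S.ε * (η + S.ε) * γ * S.α * S.c * P.L ≤ p.2.2 ∧ γ ≤ S.optEstimate e τ t p.1.2
      then Mode.predictive (t + 1) (t + 1 : ℕ) else Mode.conservative τ,
    p.1.1, Function.update p.1.2 t p.2.1)

/-- A conservative period: the action is drawn from the online oracle; the Monte Carlo estimate uses
fresh randomness. -/
noncomputable def conservativeStep (τ t : ℕ) : Kernel ((∀ i, A i) × (∀ i, A i)) (State A) :=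
  (Kernel.id ×ₖ ((S.online.act e τ t ×ₖ S.monteCarlo e τ t).comap Prod.snd measurable_snd)).map
    (S.conservativeUpdate e τ t)

/-- The requests observed up to period `t`, continued by the prediction. -/
def forecast (t : ℕ) : ∀ i, E i := splice (t + 1) e S.eStar

/-- The condition that ends the search for the batch beginning at period `t` when the periods
`t, …, n-1` have been covered. -/
def BatchStop (t : ℕ) (x : ∀ i, A i) (n : ℕ) : Prop :=
  t ≤ n ∧ (S.estimator.est (t + 1) (pre e (t + 1)) S.eStar ≤ n ∨
    S.α * S.c * P.L ≤ P.val t n (S.forecast e t) (S.offlineSeq t n (S.forecast e t) x))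

theorem exists_batchStop (t : ℕ) (x : ∀ i, A i) : ∃ n, S.BatchStop e t x n :=
  ⟨max t (S.estimator.est (t + 1) (pre e (t + 1)) S.eStar), le_max_left _ _,
    Or.inl (le_max_right _ _)⟩

open Classical in
/-- The horizon `n` at which the search stops: the batch covers the periods `t, …, n-1`. -/
noncomputable def batchEnd (t : ℕ) (x : ∀ i, A i) : ℕ := Nat.find (S.exists_batchStop e t x)

/-- The action sequence of the batch that begins at period `t`. Its entries beyond the batch are
arbitrary. -/
noncomputable def batchSeq (t : ℕ) (x : ∀ i, A i) : ∀ i, A i :=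
  S.offlineSeq t (S.batchEnd e t x) (S.forecast e t) x

open Classical in
/-- The first period after the batch; it is infinite if the predicted cost of the batch stays below
the threshold. -/
noncomputable def nextBatch (t : ℕ) (x : ∀ i, A i) : ℕ∞ :=
  if P.val t (S.batchEnd e t x) (S.forecast e t) (S.batchSeq e t x) < S.α * S.c * P.L
    then ⊤ else S.batchEnd e t x

theorem measurable_offlineSeq (m n : ℕ) (e : ∀ i, E i) : Measurable (S.offlineSeq m n e) :=
  (measurable_splice m).comp (measurable_id.prodMk
    ((S.offline.measurable_solve m n _).comp (measurable_pre m)))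

theorem measurable_conservativeUpdate (τ t : ℕ) : Measurable (S.conservativeUpdate e τ t) := by
  have hu : Measurable (S.optEstimate e τ t) :=
    (P.measurable_val _ _ _).comp (S.measurable_offlineSeq _ _ _)
  refine Measurable.prodMk (Measurable.ite ?_ measurable_const measurable_const)
    (Measurable.prodMk (measurable_fst.comp measurable_fst) ?_)
  · exact (measurableSet_le measurable_const (measurable_snd.comp measurable_snd)).inter
      (measurableSet_le measurable_const (hu.comp (measurable_snd.comp measurable_fst)))
  · exact (measurable_write t).comp ((measurable_snd.comp measurable_fst).prodMk
      (measurable_fst.comp measurable_snd))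

instance (τ t : ℕ) : IsMarkovKernel (S.monteCarlo e τ t) := by
  have := Kernel.IsMarkovKernel.map (S.online.rollout e τ (t + 1 - τ))
    (P.measurable_val τ (t + 1) e)
  exact Kernel.IsMarkovKernel.map _ (measurable_id.div_const _)

instance (τ t : ℕ) : IsMarkovKernel (S.conservativeStep e τ t) :=
  Kernel.IsMarkovKernel.map _ (S.measurable_conservativeUpdate e τ t)

theorem measurable_batchEnd (t : ℕ) : Measurable (S.batchEnd e t) := by
  classical
  refine measurable_find (S.exists_batchStop e t) fun n => ?_
  exact (MeasurableSet.const _).inter ((MeasurableSet.const _).union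
    (measurableSet_le measurable_const
      ((P.measurable_val _ _ _).comp (S.measurable_offlineSeq _ _ _))))

theorem measurable_batchSeq (t : ℕ) : Measurable (S.batchSeq e t) := by
  have h : Measurable fun p : ℕ × (∀ i, A i) => S.offlineSeq t p.1 (S.forecast e t) p.2 :=
    measurable_from_prod_countable_right fun n => S.measurable_offlineSeq t n _
  exact h.comp ((S.measurable_batchEnd e t).prodMk measurable_id)

theorem measurable_nextBatch (t : ℕ) : Measurable (S.nextBatch e t) := by
  have h : Measurable fun p : ℕ × (∀ i, A i) => P.val t p.1 (S.forecast e t) p.2 :=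
    measurable_from_prod_countable_right fun n => P.measurable_val t n _
  refine Measurable.ite (measurableSet_lt
    (h.comp ((S.measurable_batchEnd e t).prodMk (S.measurable_batchSeq e t))) measurable_const)
    measurable_const ((measurable_of_countable _).comp (S.measurable_batchEnd e t))

variable [∀ t, MetricSpace (E t)]

/-- The cumulative prediction error of the periods `σ, …, t`, truncated at `c / b` in each period. -/
noncomputable def error (σ t : ℕ) : ℝ :=
  ∑ i ∈ Finset.Icc σ t, min (dist (e i) (S.eStar i)) (S.c / S.b)

/-- The total prediction error, truncated at `c / b` in each period. -/
noncomputable def totalError : ℝ := ∑' i : ℕ, min (dist (e i) (S.eStar i)) (S.c / S.b)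

open Classical in
/-- A predictive period `t`: if a new batch starts, it is computed from the offline oracle; then the
action of the current batch is executed and the error threshold is tested. -/
noncomputable def predictiveUpdate (σ : ℕ) (τp : ℕ∞) (t : ℕ)
    (p : (∀ i, A i) × (∀ i, A i)) : State A :=
  let plan := if (t : ℕ∞) = τp then S.batchSeq e t p.2 else p.1
  let τp' := if (t : ℕ∞) = τp then S.nextBatch e t p.2 else τp
  (if 5 * (η + S.ε) * S.α * S.c / S.b ≤ S.error e σ t
      then Mode.conservative (t + 1) else Mode.predictive σ τp',
    plan, Function.update p.2 t (plan t))

theorem measurable_predictiveUpdate (σ : ℕ) (τp : ℕ∞) (t : ℕ) :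
    Measurable (S.predictiveUpdate e σ τp t) := by
  have hplan : Measurable fun p : (∀ i, A i) × (∀ i, A i) =>
      if (t : ℕ∞) = τp then S.batchSeq e t p.2 else p.1 := by
    split_ifs
    · exact (S.measurable_batchSeq e t).comp measurable_snd
    · exact measurable_fst
  refine Measurable.prodMk ?_ (hplan.prodMk ((measurable_write t).comp
    (measurable_snd.prodMk ((measurable_pi_apply t).comp hplan))))
  refine Measurable.ite (MeasurableSet.const _) measurable_const
    ((measurable_of_countable (Mode.predictive σ)).comp ?_)
  split_ifs
  · exact (S.measurable_nextBatch e t).comp measurable_snd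
  · exact measurable_const

/-- One period of AdaSwitch. -/
noncomputable def step (t : ℕ) : Kernel (State A) (State A) where
  toFun z := match z.1 with
    | .conservative τ => S.conservativeStep e τ t z.2
    | .predictive σ τp => Measure.dirac (S.predictiveUpdate e σ τp t z.2)
  measurable' := by
    refine measurable_from_prod_countable_right fun z => ?_
    cases z with
    | conservative τ => exact (S.conservativeStep e τ t).measurable
    | predictive σ τp =>
      exact Measure.measurable_dirac.comp (S.measurable_predictiveUpdate e σ τp t)

instance (t : ℕ) : IsMarkovKernel (S.step e t) := by
  refine ⟨fun z => ?_⟩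
  obtain ⟨z, p⟩ := z
  cases z with
  | conservative τ => exact (inferInstance : IsProbabilityMeasure (S.conservativeStep e τ t p))
  | predictive σ τp =>
    exact (inferInstance : IsProbabilityMeasure (Measure.dirac (S.predictiveUpdate e σ τp t p)))

variable [∀ t, Nonempty (A t)]

/-- The law of the state of AdaSwitch after `t` periods. It starts in the conservative state; the
arbitrary initial sequences are never used. -/
noncomputable def law : ℕ → Measure (State A)
  | 0 => Measure.dirac
      (Mode.conservative 0, (fun _ => Classical.arbitrary _), (fun _ => Classical.arbitrary _))
  | t + 1 => (law t).bind (S.step e t)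

instance (t : ℕ) : IsProbabilityMeasure (S.law e t) := by
  induction t with
  | zero => unfold law; infer_instance
  | succ t ih => unfold law; infer_instance

/-- The expected total cost of AdaSwitch on the request sequence `e`. -/
noncomputable def expectedCost : ℝ := ∑' t : ℕ, ∫ z, P.costAt t e z.2.2 ∂(S.law e (t + 1))

/-- The competitive ratio of AdaSwitch on the request sequence `e`. -/
noncomputable def comp : ℝ := S.expectedCost e / P.totalOpt e

end Input

end AdaSwitch

/-! All estimates compare AdaSwitch with an arbitrary fixed action sequence `a`; the infimum over
`a` is taken only at the very end, so no optimal sequence has to exist. For a horizon `N` beyond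
which costs vanish and the prediction is exact (`exists_horizon`), the expected cost is the
cost-to-go over `N` periods (`expectedCost_eq_costToGo`). Each guarantee is then a backward
induction alternating between the starts of conservative and of predictive phases.

Predictive phases. A foreign history changes the optimum by at most `c * L`, while a complete batch
has predicted cost at least `α * c * L`. The influence of the history is therefore absorbed into a
factor, and a complete batch costs at most `ratio` times the cost of `a`, up to `L * b` times
multiples of the prediction error (`val_completeBatch_le`). Only the last batch of a phase leaves an
additive term: `γ * c * L` if the phase lasts to the horizon, `γ * (α + 1) * c * L` if it is cut
short.

Conservative phases. The exit test uses only the actions before the phase and fresh randomness, so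
exiting is independent of the actions drawn during the phase. This turns the phase into a scalar
recursion with deterministic exit probabilities (`phaseValue_succ`), which Chebyshev's inequality
controls.

First bound (`stoppedPhase_le_mul`). Leaving for a predictive phase loses at most `12 * (η + ε) * γ
* α * c * L`. If the mean online cost is then near the threshold or above it, `a` itself has paid so
much that the slack between `η` and `η + ε` covers the loss. Earlier exits have probability of order
`(k + 1)⁻⁴`, and a summable share of the slack covers them.

Second bound (`stoppedPhase_le_add`). Once the mean online cost exceeds `18.5 * scale`, every period
exits with probability at least one half, so a conservative phase adds at most `19 * scale`. Every
return to the conservative state follows a prediction error of at least `errorLevel`, and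
`errorRate` is large enough for that error to pay for the next phase. -/

open scoped ENNReal

namespace AdaSwitch

/-! ### Prefixes and splices of sequences. -/

section Splice

variable {X : ℕ → Type*}

theorem pre_eq_pre_iff {n : ℕ} {x y : ∀ i, X i} : pre x n = pre y n ↔ ∀ i < n, x i = y i :=
  ⟨fun h i hi => congrFun h ⟨i, hi⟩, fun h => funext fun i => h i i.2⟩

theorem splice_of_lt {m i : ℕ} (x y : ∀ i, X i) (h : i < m) : splice m x y i = x i := if_pos h

theorem splice_of_le {m i : ℕ} (x y : ∀ i, X i) (h : m ≤ i) : splice m x y i = y i :=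
  if_neg h.not_gt

theorem splice_self (m : ℕ) (x : ∀ i, X i) : splice m x x = x := by
  funext i
  simp [splice]

theorem splice_zero (x y : ∀ i, X i) : splice 0 x y = y := by
  funext i
  simp [splice]

theorem splice_splice_right (m : ℕ) (x y z : ∀ i, X i) :
    splice m x (splice m y z) = splice m x z := by
  funext i
  by_cases h : i < m <;> simp [splice, h]

theorem pre_splice (m : ℕ) (x y : ∀ i, X i) : pre (splice m x y) m = pre x m :=
  pre_eq_pre_iff.2 fun _ hi => splice_of_lt x y hi

theorem splice_congr_left {m : ℕ} {x x' : ∀ i, X i} (y : ∀ i, X i) (h : pre x m = pre x' m) :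
    splice m x y = splice m x' y := by
  funext i
  by_cases hi : i < m
  · simp [splice, hi, pre_eq_pre_iff.1 h i hi]
  · simp [splice, hi]

theorem splice_succ (j : ℕ) (x y : ∀ i, X i) :
    splice (j + 1) x y = Function.update (splice j x y) j (x j) := by
  funext i
  rcases lt_trichotomy i j with h | h | h
  · rw [Function.update_of_ne h.ne, splice_of_lt _ _ h, splice_of_lt _ _ (by omega)]
  · subst h
    simp [splice]
  · rw [Function.update_of_ne h.ne', splice_of_le _ _ h.le, splice_of_le _ _ (by omega)]

theorem splice_update_right {m t : ℕ} (h : m ≤ t) (x y : ∀ i, X i) (z : X t) :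
    splice m x (Function.update y t z) = Function.update (splice m x y) t z := by
  funext i
  rcases eq_or_ne i t with rfl | hi
  · simp [splice, h]
  · simp [splice, hi]

theorem pre_update {n t : ℕ} (h : n ≤ t) (x : ∀ i, X i) (z : X t) :
    pre (Function.update x t z) n = pre x n :=
  pre_eq_pre_iff.2 fun i hi => Function.update_of_ne (by omega) _ _

theorem pre_eq_of_le {m n : ℕ} {x y : ∀ i, X i} (h : pre x n = pre y n) (hmn : m ≤ n) :
    pre x m = pre y m :=
  pre_eq_pre_iff.2 fun i hi => pre_eq_pre_iff.1 h i (hi.trans_le hmn)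

end Splice

/-! ### Costs, optima, and their sensitivity to history and requests. -/

namespace CostProblem

variable {E A : ℕ → Type*} [∀ t, MeasurableSpace (A t)] (P : CostProblem E A)

theorem costAt_nonneg (t : ℕ) (e : ∀ i, E i) (a : ∀ i, A i) : 0 ≤ P.costAt t e a :=
  (P.cost_mem _ _ _).1

theorem costAt_le (t : ℕ) (e : ∀ i, E i) (a : ∀ i, A i) : P.costAt t e a ≤ P.L :=
  (P.cost_mem _ _ _).2

theorem costAt_congr {t : ℕ} {e e' : ∀ i, E i} {a a' : ∀ i, A i}
    (he : pre e (t + 1) = pre e' (t + 1)) (ha : pre a (t + 1) = pre a' (t + 1)) :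
    P.costAt t e a = P.costAt t e' a' := by
  rw [costAt, costAt, he, ha]

theorem val_congr {m n : ℕ} {e e' : ∀ i, E i} {a a' : ∀ i, A i}
    (he : pre e n = pre e' n) (ha : pre a n = pre a' n) :
    P.val m n e a = P.val m n e' a' := by
  rw [val_coe, val_coe]
  refine Finset.sum_congr rfl fun t ht => ?_
  have := (Finset.mem_Ico.1 ht).2
  exact P.costAt_congr (pre_eq_of_le he this) (pre_eq_of_le ha this)

theorem val_nonneg (m : ℕ) (n : ℕ∞) (e : ∀ i, E i) (a : ∀ i, A i) : 0 ≤ P.val m n e a := by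
  refine tsum_nonneg fun t => ?_
  split_ifs
  exacts [P.costAt_nonneg _ _ _, le_rfl]

theorem val_self (m : ℕ) (e : ∀ i, E i) (a : ∀ i, A i) : P.val m m e a = 0 := by
  simp [val_coe]

theorem val_succ {m n : ℕ} (h : m ≤ n) (e : ∀ i, E i) (a : ∀ i, A i) :
    P.val m (n + 1 : ℕ) e a = P.val m n e a + P.costAt n e a := by
  rw [val_coe, val_coe, Finset.sum_Ico_succ_top h]

theorem val_add {m n k : ℕ} (h : m ≤ n) (h' : n ≤ k) (e : ∀ i, E i) (a : ∀ i, A i) :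
    P.val m n e a + P.val n k e a = P.val m k e a := by
  rw [val_coe, val_coe, val_coe, Finset.sum_Ico_consecutive _ h h']

theorem val_mono {m n k : ℕ} (h : n ≤ k) (e : ∀ i, E i) (a : ∀ i, A i) :
    P.val m n e a ≤ P.val m k e a := by
  rw [val_coe, val_coe]
  exact Finset.sum_le_sum_of_subset_of_nonneg (Finset.Ico_subset_Ico_right h)
    fun _ _ _ => P.costAt_nonneg _ _ _

theorem val_le (m n : ℕ) (e : ∀ i, E i) (a : ∀ i, A i) :
    P.val m n e a ≤ (n - m : ℕ) * P.L := by
  rw [val_coe]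
  refine (Finset.sum_le_sum fun t _ => P.costAt_le t e a).trans ?_
  simp

theorem bddBelow_range_val (m : ℕ) (n : ℕ∞) (e : ∀ i, E i) (a : ∀ i, A i) :
    BddBelow (Set.range fun a' : ∀ i, A i => P.val m n e (splice m a a')) :=
  ⟨0, by rintro _ ⟨a', rfl⟩; exact P.val_nonneg _ _ _ _⟩

theorem opt_le_val (m : ℕ) (n : ℕ∞) (e : ∀ i, E i) (a a' : ∀ i, A i) :
    P.opt m n e a ≤ P.val m n e (splice m a a') :=
  ciInf_le (P.bddBelow_range_val m n e a) a'

theorem opt_le_val_self (m : ℕ) (n : ℕ∞) (e : ∀ i, E i) (a : ∀ i, A i) :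
    P.opt m n e a ≤ P.val m n e a := by
  simpa [splice_self] using P.opt_le_val m n e a a

variable {P}

theorem costAt_eq_zero_of_effLen_le {e : ∀ i, E i} {t : ℕ} (h : P.effLen e ≤ t) (a : ∀ i, A i) :
    P.costAt t e a = 0 := by
  have hmem : P.effLen e ∈
      {M : ℕ∞ | ∀ t : ℕ, M ≤ t → ∀ a : ∀ i, A i, P.costAt t e a = 0} :=
    csInf_mem ⟨⊤, fun t ht => absurd ht (by simp)⟩
  exact hmem t h a

theorem val_eq_of_effLen_le {e : ∀ i, E i} {M n m : ℕ} (h : P.effLen e ≤ M) (hn : M ≤ n)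
    (a : ∀ i, A i) : P.val m n e a = P.val m M e a := by
  induction n, hn using Nat.le_induction with
  | base => rfl
  | succ n hn ih =>
    rcases le_or_gt m n with hm | hm
    · rw [P.val_succ hm, ih, costAt_eq_zero_of_effLen_le (h.trans (by exact_mod_cast hn)), add_zero]
    · rw [val_coe, val_coe, Finset.Ico_eq_empty (by omega), Finset.Ico_eq_empty (by omega)]

theorem val_top_eq_of_effLen_le {e : ∀ i, E i} {M : ℕ} (h : P.effLen e ≤ M) (m : ℕ)
    (a : ∀ i, A i) : P.val m ⊤ e a = P.val m M e a := by
  rw [val, val]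
  refine tsum_congr fun t => ?_
  rcases lt_or_ge t M with ht | ht
  · simp [ht]
  · rw [costAt_eq_zero_of_effLen_le (h.trans (by exact_mod_cast ht))]
    simp

theorem IsFinite.effLen_lt {e : ∀ i, E i} (h : P.IsFinite e) : P.effLen e < ⊤ := by
  simpa [splice_zero] using h 0 e

/-- Two successive prefix substitutions amount to a single one, of length `max k n`. -/
theorem IsFinite.splice {e : ∀ i, E i} (h : P.IsFinite e) (n : ℕ) (e' : ∀ i, E i) :
    P.IsFinite (splice n e' e) := by
  intro k e''
  have : AdaSwitch.splice k e'' (AdaSwitch.splice n e' e) =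
      AdaSwitch.splice (max k n) (AdaSwitch.splice k e'' (AdaSwitch.splice n e' e)) e := by
    funext i
    by_cases h1 : i < k <;> by_cases h2 : i < n <;> simp [AdaSwitch.splice, h1, h2]
  rw [this]
  exact h _ _

theorem BoundedInfluence.opt_le {f : ℝ} (h : P.BoundedInfluence f) {e : ∀ i, E i}
    (he : P.IsFinite e) {m n : ℕ} (hmn : m < n) (a a' : ∀ i, A i) :
    P.opt m n e a ≤ P.val m n e a' + f * P.L := by
  have h1 := h m n e e a a' (by exact_mod_cast hmn) he
  rw [splice_self] at h1
  have h2 := P.opt_le_val_self m n e a'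
  have h3 := (abs_le.1 h1).2
  linarith

theorem L_nonneg (P : CostProblem E A) (e : ∀ i, E i) (a : ∀ i, A i) : 0 ≤ P.L :=
  (P.costAt_nonneg 0 e a).trans (P.costAt_le 0 e a)

variable [∀ t, MetricSpace (E t)]

/-- Hybrid argument: the requests are exchanged one at a time. Exchanging request `j` leaves the
costs before period `j` unchanged, so the hypothesis is needed only from period `j` on. The
truncation level `c / b` is what `min (b * d) v ≤ b * min d (c / b)` requires. -/
theorem StronglyLipschitz.abs_val_sub_val_le {u v b c : ℝ} (h : P.StronglyLipschitz u v)
    (hb : b = u) (hb0 : 0 < b) (hc : v ≤ c) {e e' : ∀ i, E i} (he : P.IsFinite e) {m n : ℕ}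
    (hpre : pre e m = pre e' m) (a : ∀ i, A i) :
    |P.val m n e a - P.val m n e' a| ≤
      P.L * b * ∑ i ∈ Finset.Ico m n, min (dist (e i) (e' i)) (c / b) := by
  subst hb
  have hL : 0 ≤ P.L := P.L_nonneg e a
  have hmin : ∀ d : ℝ, min (b * d) v ≤ b * min d (c / b) := fun d => by
    rw [mul_min_of_nonneg _ _ hb0.le, mul_div_cancel₀ _ hb0.ne']
    exact min_le_min_left _ hc
  rcases lt_or_ge n m with hnm | hnm
  · simp [val_coe, Finset.Ico_eq_empty_of_le hnm.le]
  have key : ∀ j, m ≤ j → j ≤ n → |P.val m n e a - P.val m n (splice j e' e) a| ≤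
      P.L * b * ∑ i ∈ Finset.Ico m j, min (dist (e i) (e' i)) (c / b) := by
    intro j hj
    induction j, hj using Nat.le_induction with
    | base =>
      intro _
      have : splice m e' e = e := by rw [splice_congr_left e hpre.symm, splice_self]
      simp [this]
    | succ j hj ih =>
      intro hjn
      have h1 := ih (by omega)
      have h2 := h j n (splice j e' e) (e' j) a (by omega) (he.splice _ _)
      rw [← splice_succ] at h2
      rw [splice_of_le _ _ le_rfl] at h2
      have h3 : P.val m n (splice j e' e) a - P.val m n (splice (j + 1) e' e) a =
          P.val j n (splice j e' e) a - P.val j n (splice (j + 1) e' e) a := by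
        rw [← P.val_add hj (by omega : j ≤ n), ← P.val_add hj (by omega : j ≤ n)]
        rw [P.val_congr (m := m) (n := j) (e := splice (j + 1) e' e) (e' := splice j e' e)
          (a := a) (a' := a) _ rfl]
        · ring
        · rw [pre_splice]
          exact pre_eq_of_le (pre_splice (j + 1) e' e) (by omega)
      have h4 : |P.val m n e a - P.val m n (splice (j + 1) e' e) a| ≤
          |P.val m n e a - P.val m n (splice j e' e) a| +
          |P.val m n (splice j e' e) a - P.val m n (splice (j + 1) e' e) a| := abs_sub_le _ _ _
      rw [Finset.sum_Ico_succ_top hj, mul_add]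
      have h5 := mul_le_mul_of_nonneg_left (hmin (dist (e j) (e' j))) hL
      rw [h3] at h4
      linarith [mul_assoc P.L b (min (dist (e j) (e' j)) (c / b))]
  have h1 := key n hnm le_rfl
  rwa [P.val_congr (m := m) (n := n) (e := splice n e' e) (e' := e') (a := a) (a' := a)
    (pre_splice _ _ _) rfl] at h1

end CostProblem

/-! ### Integrals of bounded functions. -/

theorem integrable_of_abs_le {α : Type*} [MeasurableSpace α] {μ : Measure α} [IsFiniteMeasure μ]
    {f : α → ℝ} (hf : Measurable f) {C : ℝ} (hC : ∀ x, |f x| ≤ C) : Integrable f μ :=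
  Integrable.of_bound hf.aestronglyMeasurable C (Filter.Eventually.of_forall hC)

theorem abs_integral_le_of_abs_le {α : Type*} [MeasurableSpace α] {μ : Measure α}
    [IsProbabilityMeasure μ] {f : α → ℝ} {C : ℝ} (hC : ∀ x, |f x| ≤ C) :
    |∫ x, f x ∂μ| ≤ C := by
  have h := norm_integral_le_of_norm_le_const (μ := μ) (f := f) (Filter.Eventually.of_forall hC)
  simpa using h

theorem measurable_integral_kernel {α β : Type*} [MeasurableSpace α] [MeasurableSpace β]
    (κ : Kernel α β) {f : β → ℝ} (hf : Measurable f) : Measurable fun x => ∫ y, f y ∂κ x :=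
  (hf.stronglyMeasurable.integral_kernel (κ := κ)).measurable

theorem integral_bind_kernel {α β : Type*} [MeasurableSpace α] [MeasurableSpace β]
    (μ : Measure α) [IsProbabilityMeasure μ] (κ : Kernel α β) [IsMarkovKernel κ] {f : β → ℝ}
    (hf : Measurable f) {C : ℝ} (hC : ∀ x, |f x| ≤ C) :
    ∫ y, f y ∂(μ.bind κ) = ∫ x, ∫ y, f y ∂κ x ∂μ := by
  have h : μ.bind κ = (κ ∘ₖ Kernel.const Unit μ) () := by
    rw [Kernel.comp_apply, Kernel.const_apply]
  rw [h, Kernel.integral_comp (integrable_of_abs_le hf hC), Kernel.const_apply]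

variable {E A : ℕ → Type*} [∀ t, MeasurableSpace (A t)]

/-! ### Rollouts of online policies. -/

namespace PolicyClass

variable (π : PolicyClass E A) (e : ∀ i, E i)

theorem act_congr {m t : ℕ} {x y : ∀ i, A i} (h : pre x t = pre y t) :
    π.act e m t x = π.act e m t y := by
  simp only [act, Kernel.comap_apply, h]

theorem writeKernel_apply (m t : ℕ) (y : ∀ i, A i) :
    ((Kernel.id ×ₖ π.act e m t).map (fun p : (∀ i, A i) × A t => Function.update p.1 t p.2)) y =
      (π.act e m t y).map (fun a => Function.update y t a) := by
  rw [Kernel.map_apply _ (measurable_write t), Kernel.prod_apply, Kernel.id_apply,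
    Measure.dirac_prod, Measure.map_map (measurable_write t) measurable_prodMk_left]
  rfl

theorem measurable_update_right (t : ℕ) (y : ∀ i, A i) :
    Measurable fun a : A t => Function.update y t a :=
  (measurable_write t).comp measurable_prodMk_left

theorem lintegral_rollout_succ (m k : ℕ) (x : ∀ i, A i) {f : (∀ i, A i) → ℝ≥0∞}
    (hf : Measurable f) :
    ∫⁻ z, f z ∂(π.rollout e m (k + 1) x) = ∫⁻ y, ∫⁻ a, f (Function.update y (m + k) a)
      ∂(π.act e m (m + k) y) ∂(π.rollout e m k x) := by
  rw [rollout, Kernel.lintegral_comp _ _ _ hf]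
  refine lintegral_congr fun y => ?_
  rw [writeKernel_apply, lintegral_map hf (measurable_update_right _ _)]

theorem integral_rollout_succ (m k : ℕ) (x : ∀ i, A i) {f : (∀ i, A i) → ℝ}
    (hf : Measurable f) {C : ℝ} (hC : ∀ x, |f x| ≤ C) :
    ∫ z, f z ∂(π.rollout e m (k + 1) x) = ∫ y, ∫ a, f (Function.update y (m + k) a)
      ∂(π.act e m (m + k) y) ∂(π.rollout e m k x) := by
  have := integrable_of_abs_le (μ := π.rollout e m (k + 1) x) hf hC
  rw [rollout] at this ⊢
  rw [Kernel.integral_comp this]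
  refine integral_congr_ae (Filter.Eventually.of_forall fun y => ?_)
  simp only
  rw [writeKernel_apply, integral_map (measurable_update_right _ _).aemeasurable
    hf.aestronglyMeasurable]

theorem measurable_lintegral_act (m t : ℕ) {f : (∀ i, A i) → ℝ≥0∞} (hf : Measurable f) :
    Measurable fun y => ∫⁻ a, f (Function.update y t a) ∂(π.act e m t y) := by
  have h := hf.lintegral_kernel (κ := (Kernel.id ×ₖ π.act e m t).map
    (fun p : (∀ i, A i) × A t => Function.update p.1 t p.2))
  convert! h using 2 with y
  rw [writeKernel_apply, lintegral_map hf (measurable_update_right _ _)]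

theorem measurable_integral_act (m t : ℕ) {f : (∀ i, A i) → ℝ} (hf : Measurable f) :
    Measurable fun y => ∫ a, f (Function.update y t a) ∂(π.act e m t y) := by
  have h := measurable_integral_kernel ((Kernel.id ×ₖ π.act e m t).map
    (fun p : (∀ i, A i) × A t => Function.update p.1 t p.2)) hf
  convert! h using 2 with y
  rw [writeKernel_apply, integral_map (measurable_update_right _ _).aemeasurable
    hf.aestronglyMeasurable]

/-- A rollout never overwrites the first `m` entries of its input. Stated through integrals, this
lets a function of the history be treated as a constant under the rollout. -/
theorem lintegral_rollout_splice (m k : ℕ) (x : ∀ i, A i) {f : (∀ i, A i) → ℝ≥0∞}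
    (hf : Measurable f) :
    ∫⁻ y, f (splice m x y) ∂(π.rollout e m k x) = ∫⁻ y, f y ∂(π.rollout e m k x) := by
  have hs : Measurable fun y : ∀ i, A i => splice m x y :=
    (measurable_splice m).comp measurable_prodMk_left
  induction k generalizing f with
  | zero =>
    have hfs : Measurable fun y => f (splice m x y) := hf.comp hs
    rw [rollout, Kernel.id_apply, lintegral_dirac' _ hfs, lintegral_dirac' _ hf,
      splice_self]
  | succ k ih =>
    have hfs : Measurable fun y => f (splice m x y) := hf.comp hs
    rw [lintegral_rollout_succ _ _ _ _ _ hf, lintegral_rollout_succ _ _ _ _ _ hfs,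
      ← ih (π.measurable_lintegral_act e m (m + k) hfs),
      ← ih (π.measurable_lintegral_act e m (m + k) hf)]
    simp only [splice_update_right (Nat.le_add_right m k), splice_splice_right]

theorem rollout_map_splice (m k : ℕ) (x : ∀ i, A i) :
    (π.rollout e m k x).map (splice m x) = π.rollout e m k x := by
  have hs : Measurable fun y : ∀ i, A i => splice m x y :=
    (measurable_splice m).comp measurable_prodMk_left
  refine Measure.ext_of_lintegral _ fun f hf => ?_
  rw [lintegral_map hf hs, lintegral_rollout_splice _ _ _ _ _ hf]

theorem integral_rollout_splice (m k : ℕ) (x : ∀ i, A i) {f : (∀ i, A i) → ℝ}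
    (hf : Measurable f) :
    ∫ y, f (splice m x y) ∂(π.rollout e m k x) = ∫ y, f y ∂(π.rollout e m k x) := by
  have hs : Measurable fun y : ∀ i, A i => splice m x y :=
    (measurable_splice m).comp measurable_prodMk_left
  conv_rhs => rw [← π.rollout_map_splice e m k x]
  rw [integral_map hs.aemeasurable hf.aestronglyMeasurable]

/-- The entries of the input from `m` on are never read: they are overwritten before the policy
looks at them, and `f` sees only what has been written. -/
theorem lintegral_rollout_congr (m k : ℕ) {x x' : ∀ i, A i} (h : pre x m = pre x' m)
    {f : (∀ i, A i) → ℝ≥0∞} (hf : Measurable f)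
    (hdep : ∀ y y', pre y (m + k) = pre y' (m + k) → f y = f y') :
    ∫⁻ y, f y ∂(π.rollout e m k x) = ∫⁻ y, f y ∂(π.rollout e m k x') := by
  induction k generalizing f with
  | zero =>
    rw [rollout, Kernel.id_apply, Kernel.id_apply, lintegral_dirac' _ hf, lintegral_dirac' _ hf]
    exact hdep _ _ h
  | succ k ih =>
    rw [lintegral_rollout_succ _ _ _ _ _ hf, lintegral_rollout_succ _ _ _ _ _ hf]
    refine ih (π.measurable_lintegral_act e m (m + k) hf) fun y y' hy => ?_
    rw [π.act_congr e hy]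
    refine lintegral_congr fun a => hdep _ _ (pre_eq_pre_iff.2 fun i hi => ?_)
    rcases eq_or_ne i (m + k) with rfl | hne
    · simp
    · simpa [hne] using pre_eq_pre_iff.1 hy i (by omega)

theorem map_rollout_congr {β : Type*} [MeasurableSpace β] (m k : ℕ) {x x' : ∀ i, A i}
    (h : pre x m = pre x' m) {g : (∀ i, A i) → β} (hg : Measurable g)
    (hdep : ∀ y y', pre y (m + k) = pre y' (m + k) → g y = g y') :
    (π.rollout e m k x).map g = (π.rollout e m k x').map g := by
  refine Measure.ext_of_lintegral _ fun f hf => ?_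
  rw [lintegral_map hf hg, lintegral_map hf hg]
  exact π.lintegral_rollout_congr e m k h (hf.comp hg) fun y y' hy => congrArg f (hdep y y' hy)

theorem integral_rollout_succ_eq (m k : ℕ) (x : ∀ i, A i) {f : (∀ i, A i) → ℝ}
    (hf : Measurable f) {C : ℝ} (hC : ∀ x, |f x| ≤ C)
    (hdep : ∀ y y', pre y (m + k) = pre y' (m + k) → f y = f y') :
    ∫ z, f z ∂(π.rollout e m (k + 1) x) = ∫ y, f y ∂(π.rollout e m k x) := by
  rw [π.integral_rollout_succ e m k x hf hC]
  refine integral_congr_ae (Filter.Eventually.of_forall fun y => ?_)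
  have : ∀ a, f (Function.update y (m + k) a) = f y := fun a => hdep _ _ (pre_update le_rfl y a)
  simp [this]

variable (P : CostProblem E A)

theorem abs_costAt_le (t : ℕ) (a : ∀ i, A i) : |P.costAt t e a| ≤ P.L := by
  rw [abs_of_nonneg (P.costAt_nonneg _ _ _)]
  exact P.costAt_le _ _ _

theorem abs_val_le (m n : ℕ) (a : ∀ i, A i) : |P.val m n e a| ≤ (n - m : ℕ) * P.L := by
  rw [abs_of_nonneg (P.val_nonneg _ _ _ _)]
  exact P.val_le _ _ _ _

theorem integral_val_rollout_succ (m k : ℕ) (x : ∀ i, A i) :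
    ∫ y, P.val m (m + (k + 1) : ℕ) e y ∂(π.rollout e m (k + 1) x) =
      ∫ y, P.val m (m + k : ℕ) e y ∂(π.rollout e m k x) +
      ∫ y, P.costAt (m + k) e y ∂(π.rollout e m (k + 1) x) := by
  rw [← π.integral_rollout_succ_eq e m k x (P.measurable_val m (m + k) e) (abs_val_le e P m (m + k))
    fun y y' h => P.val_congr rfl h, ← integral_add]
  · refine integral_congr_ae (Filter.Eventually.of_forall fun y => ?_)
    exact P.val_succ (Nat.le_add_right m k) e y
  · exact integrable_of_abs_le (P.measurable_val _ _ _) (abs_val_le e P m (m + k))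
  · exact integrable_of_abs_le (P.measurable_costAt _ _) (abs_costAt_le e P _)

theorem val_eq_integral (m k : ℕ) (x : ∀ i, A i) :
    π.val e P m (m + k : ℕ) x = ∫ y, P.val m (m + k : ℕ) e y ∂(π.rollout e m k x) := by
  have hval : ∀ n : ℕ, π.val e P m n x = ∑ t ∈ Finset.Ico m n,
      ∫ y, P.costAt t e y ∂(π.rollout e m (t + 1 - m) x) := by
    intro n
    rw [PolicyClass.val, tsum_eq_sum (s := Finset.Ico m n)]
    · refine Finset.sum_congr rfl fun t ht => ?_
      rw [if_pos]
      simpa using ht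
    · intro t ht
      rw [if_neg]
      simpa using ht
  induction k with
  | zero => simp [hval, CostProblem.val_coe]
  | succ k ih =>
    rw [integral_val_rollout_succ, ← ih, hval, hval, ← add_assoc,
      Finset.sum_Ico_succ_top (Nat.le_add_right m k)]
    congr 4
    omega

end PolicyClass

/-! ### Chebyshev's inequality for averages of independent samples. -/

section SumLaw

variable {α : Type*} [MeasurableSpace α] (κ : Kernel α ℝ) [IsMarkovKernel κ]

theorem sumLaw_succ_apply (N : ℕ) (x : α) :
    sumLaw κ (N + 1) x = ((sumLaw κ N x).prod (κ x)).map (fun p => p.1 + p.2) := by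
  rw [sumLaw, Kernel.map_apply _ (by fun_prop), Kernel.prod_apply]

theorem sumLaw_congr {x x' : α} (h : κ x = κ x') (N : ℕ) : sumLaw κ N x = sumLaw κ N x' := by
  induction N with
  | zero => simp [sumLaw]
  | succ N ih => rw [sumLaw_succ_apply, sumLaw_succ_apply, ih, h]

variable {κ} {B : ℝ} {x : α}

theorem ae_mem_Icc_sumLaw (h : ∀ᵐ r ∂κ x, r ∈ Set.Icc 0 B) (N : ℕ) :
    ∀ᵐ r ∂sumLaw κ N x, r ∈ Set.Icc 0 (N * B) := by
  induction N with
  | zero =>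
    rw [sumLaw, Kernel.const_apply]
    exact (ae_dirac_iff (p := (· ∈ Set.Icc 0 (((0 : ℕ) : ℝ) * B))) measurableSet_Icc).2 (by simp)
  | succ N ih =>
    rw [sumLaw_succ_apply]
    refine (ae_map_iff (p := (· ∈ Set.Icc 0 (((N + 1 : ℕ) : ℝ) * B))) (by fun_prop)
      measurableSet_Icc).2 ?_
    have h1 : ∀ᵐ p ∂(sumLaw κ N x).prod (κ x), p.1 ∈ Set.Icc 0 (N * B) :=
      Measure.quasiMeasurePreserving_fst.ae ih
    have h2 : ∀ᵐ p ∂(sumLaw κ N x).prod (κ x), p.2 ∈ Set.Icc 0 B :=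
      Measure.quasiMeasurePreserving_snd.ae h
    filter_upwards [h1, h2] with p hp1 hp2
    refine ⟨add_nonneg hp1.1 hp2.1, ?_⟩
    push_cast
    linarith [hp1.2, hp2.2]

theorem memLp_id_of_ae_mem_Icc {ν : Measure ℝ} [IsFiniteMeasure ν] {a b : ℝ}
    (h : ∀ᵐ r ∂ν, r ∈ Set.Icc a b) : MemLp id 2 ν :=
  memLp_of_bounded h measurable_id.aestronglyMeasurable 2

theorem integral_sumLaw (h : ∀ᵐ r ∂κ x, r ∈ Set.Icc 0 B) (N : ℕ) :
    ∫ r, r ∂sumLaw κ N x = N * ∫ r, r ∂κ x := by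
  induction N with
  | zero => simp [sumLaw]
  | succ N ih =>
    have h1 : Integrable (fun r : ℝ => r) (sumLaw κ N x) :=
      (memLp_id_of_ae_mem_Icc (ae_mem_Icc_sumLaw h N)).integrable (by norm_num)
    have h2 : Integrable (fun r : ℝ => r) (κ x) :=
      (memLp_id_of_ae_mem_Icc h).integrable (by norm_num)
    rw [sumLaw_succ_apply, integral_map (by fun_prop) (by fun_prop),
      integral_add (h1.comp_fst _) (h2.comp_snd _), integral_fun_fst (fun r : ℝ => r),
      integral_fun_snd (fun r : ℝ => r), ih]
    simp
    ring

theorem variance_sumLaw (h : ∀ᵐ r ∂κ x, r ∈ Set.Icc 0 B) (N : ℕ) :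
    Var[id; sumLaw κ N x] = N * Var[id; κ x] := by
  induction N with
  | zero => simp [sumLaw]
  | succ N ih =>
    rw [sumLaw_succ_apply, variance_id_map (by fun_prop)]
    have := variance_add_prod (memLp_id_of_ae_mem_Icc (ae_mem_Icc_sumLaw h N))
      (memLp_id_of_ae_mem_Icc h)
    rw [ih] at this
    refine this.trans ?_
    push_cast
    ring

/-- On `[0, B]` one has `r ^ 2 ≤ B * r`. A bound proportional to the mean, rather than `B ^ 2`, is
essential: the probability of a premature exit can then be charged to the cost incurred so far. -/
theorem variance_id_le_mul_integral {ν : Measure ℝ} [IsProbabilityMeasure ν]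
    (h : ∀ᵐ r ∂ν, r ∈ Set.Icc 0 B) : Var[id; ν] ≤ B * ∫ r, r ∂ν := by
  have hL := memLp_id_of_ae_mem_Icc h
  refine (variance_le_expectation_sq (by fun_prop)).trans ?_
  rw [← integral_const_mul]
  refine integral_mono_ae hL.integrable_sq ((hL.integrable (by norm_num)).const_mul B) ?_
  filter_upwards [h] with r hr
  simp only [Pi.pow_apply, id]
  nlinarith [hr.1, hr.2]

/-- Chebyshev's inequality for the average of independent samples from `[0, B]`. -/
theorem measureReal_sumLaw_average_le (h : ∀ᵐ r ∂κ x, r ∈ Set.Icc 0 B) {N : ℕ} (hN : 0 < N)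
    {δ : ℝ} (hδ : 0 < δ) :
    ((sumLaw κ N).map (fun r => r / (N : ℝ)) x).real {s | δ ≤ |s - ∫ r, r ∂κ x|} ≤
      B * (∫ r, r ∂κ x) / (N * δ ^ 2) := by
  set μ := ∫ r, r ∂κ x with hμ
  have hN' : (0 : ℝ) < N := by exact_mod_cast hN
  have hmeas : MeasurableSet {s : ℝ | δ ≤ |s - μ|} :=
    measurableSet_le measurable_const (by fun_prop)
  rw [Kernel.map_apply _ (by fun_prop), map_measureReal_apply (by fun_prop) hmeas]
  have hL := memLp_id_of_ae_mem_Icc (ae_mem_Icc_sumLaw h N)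
  have h1 := meas_ge_le_variance_div_sq hL (c := N * δ) (by positivity)
  have hset : (fun r : ℝ => r / (N : ℝ)) ⁻¹' {s | δ ≤ |s - μ|} =
      {r | N * δ ≤ |id r - (sumLaw κ N x)[id]|} := by
    ext r
    have h2 : (sumLaw κ N x)[id] = N * μ := integral_sumLaw h N
    have h3 : id r - N * μ = N * (r / N - μ) := by
      simp only [id]
      field_simp
    simp only [Set.mem_preimage, Set.mem_ofPred_eq]
    rw [h2, h3, abs_mul, abs_of_pos hN', mul_le_mul_iff_right₀ hN']
  have hvar : 0 ≤ Var[id; sumLaw κ N x] := variance_nonneg _ _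
  rw [hset, measureReal_def]
  refine (ENNReal.toReal_mono ENNReal.ofReal_ne_top h1).trans ?_
  rw [ENNReal.toReal_ofReal (by positivity), variance_sumLaw h N]
  have h4 := variance_id_le_mul_integral h
  rw [div_le_div_iff₀ (by positivity) (by positivity)]
  have : N * Var[id; κ x] * (N * δ ^ 2) = Var[id; κ x] * (N * δ) ^ 2 := by ring
  rw [this]
  exact mul_le_mul_of_nonneg_right h4 (by positivity)

end SumLaw

/-! ### The Monte Carlo exit test. -/

namespace Input

variable {P : CostProblem E A} {γ η f : ℝ} (S : Input P γ η f) (e : ∀ i, E i)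

/-- The expected cost of the first `k` periods of the online oracle started at period `τ`. -/
noncomputable def onlineMean (τ : ℕ) (x : ∀ i, A i) (k : ℕ) : ℝ :=
  ∫ y, P.val τ (τ + k : ℕ) e y ∂(S.online.rollout e τ k x)

theorem onlineMean_nonneg (τ : ℕ) (x : ∀ i, A i) (k : ℕ) : 0 ≤ S.onlineMean e τ x k :=
  integral_nonneg fun _ => P.val_nonneg _ _ _ _

theorem onlineMean_zero (τ : ℕ) (x : ∀ i, A i) : S.onlineMean e τ x 0 = 0 := by
  simp [onlineMean, CostProblem.val_coe]

theorem onlineMean_succ (τ : ℕ) (x : ∀ i, A i) (k : ℕ) :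
    S.onlineMean e τ x (k + 1) = S.onlineMean e τ x k +
      ∫ y, P.costAt (τ + k) e y ∂(S.online.rollout e τ (k + 1) x) :=
  S.online.integral_val_rollout_succ e P τ k x

theorem onlineMean_le_succ (τ : ℕ) (x : ∀ i, A i) (k : ℕ) :
    S.onlineMean e τ x k ≤ S.onlineMean e τ x (k + 1) := by
  rw [onlineMean_succ]
  exact le_add_of_nonneg_right (integral_nonneg fun _ => P.costAt_nonneg _ _ _)

theorem onlineMean_succ_le (τ : ℕ) (x : ∀ i, A i) (k : ℕ) :
    S.onlineMean e τ x (k + 1) ≤ S.onlineMean e τ x k + P.L := by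
  rw [onlineMean_succ]
  have := abs_integral_le_of_abs_le (μ := S.online.rollout e τ (k + 1) x)
    (PolicyClass.abs_costAt_le e P (τ + k))
  linarith [le_abs_self (∫ y, P.costAt (τ + k) e y ∂(S.online.rollout e τ (k + 1) x))]

theorem onlineMean_le_mul (τ : ℕ) (x : ∀ i, A i) (k : ℕ) :
    S.onlineMean e τ x k ≤ k * P.L := by
  have := abs_integral_le_of_abs_le (μ := S.online.rollout e τ k x)
    (PolicyClass.abs_val_le e P τ (τ + k))
  rw [add_tsub_cancel_left] at this
  exact (le_abs_self _).trans this

theorem monteCarlo_congr {τ k : ℕ} {x x' : ∀ i, A i} (h : pre x τ = pre x' τ) :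
    S.monteCarlo e τ (τ + k) x = S.monteCarlo e τ (τ + k) x' := by
  have hk : τ + k + 1 - τ = k + 1 := by omega
  have hm := P.measurable_val τ (τ + k + 1) e
  have := Kernel.IsMarkovKernel.map (S.online.rollout e τ (τ + k + 1 - τ)) hm
  rw [monteCarlo, Kernel.map_apply _ (by fun_prop), Kernel.map_apply _ (by fun_prop)]
  rw [sumLaw_congr _ (x := x) (x' := x')]
  rw [Kernel.map_apply _ hm, Kernel.map_apply _ hm, hk]
  exact S.online.map_rollout_congr e τ (k + 1) h hm fun y y' hy => P.val_congr rfl hy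

/-- Concentration of the Monte Carlo estimate around the expected online cost. -/
theorem monteCarlo_deviation_le (hH : 1 ≤ S.H) (τ k : ℕ) (x : ∀ i, A i) (hL : 0 ≤ P.L) {δ : ℝ}
    (hδ : 0 < δ) :
    (S.monteCarlo e τ (τ + k) x).real {s | δ ≤ |s - S.onlineMean e τ x (k + 1)|} ≤
      P.L * S.onlineMean e τ x (k + 1) / ((k + 1) ^ 4 * δ ^ 2) := by
  have hk : τ + k + 1 - τ = k + 1 := by omega
  have hm := P.measurable_val τ (τ + k + 1) e
  set κ := (S.online.rollout e τ (τ + k + 1 - τ)).map (P.val τ (τ + k + 1 : ℕ) e) with hκ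
  have : IsMarkovKernel κ := Kernel.IsMarkovKernel.map _ hm
  have hκx : κ x = (S.online.rollout e τ (k + 1) x).map (P.val τ (τ + k + 1 : ℕ) e) := by
    rw [hκ, Kernel.map_apply _ hm, hk]
  have hμ : ∫ r, r ∂κ x = S.onlineMean e τ x (k + 1) := by
    rw [hκx, integral_map hm.aemeasurable (by fun_prop)]
    rfl
  have hB : ∀ᵐ r ∂κ x, r ∈ Set.Icc 0 ((k + 1 : ℕ) * P.L) := by
    rw [hκx]
    refine (ae_map_iff (p := (· ∈ Set.Icc 0 ((k + 1 : ℕ) * P.L))) hm.aemeasurable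
      measurableSet_Icc).2 ?_
    refine Filter.Eventually.of_forall fun y => ⟨P.val_nonneg _ _ _ _, ?_⟩
    have h1 := P.val_le τ (τ + k + 1) e y
    rwa [hk] at h1
  have hN : 0 < S.H * (τ + k + 1) ^ 5 := by positivity
  have h := measureReal_sumLaw_average_le hB hN hδ
  rw [hμ] at h
  refine h.trans ?_
  have h0 := S.onlineMean_nonneg e τ x (k + 1)
  -- The sample size is bounded through the age of the phase alone. One of the five powers is lost
  -- to the range `(k + 1) * L` of a sample, leaving the fourth power.
  have hN' : ((k : ℝ) + 1) ^ 5 ≤ ((S.H * (τ + k + 1) ^ 5 : ℕ) : ℝ) := by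
    have : (k + 1) ^ 5 ≤ S.H * (τ + k + 1) ^ 5 := by
      calc (k + 1) ^ 5 ≤ (τ + k + 1) ^ 5 := Nat.pow_le_pow_left (by omega) 5
        _ ≤ _ := Nat.le_mul_of_pos_left _ hH
    exact_mod_cast this
  calc ((k + 1 : ℕ) * P.L) * S.onlineMean e τ x (k + 1) /
        (((S.H * (τ + k + 1) ^ 5 : ℕ) : ℝ) * δ ^ 2)
      ≤ ((k + 1 : ℕ) * P.L) * S.onlineMean e τ x (k + 1) / (((k : ℝ) + 1) ^ 5 * δ ^ 2) := by
        gcongr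
    _ = _ := by
        push_cast
        field_simp

/-- The threshold on the simulated cost that ends a conservative phase. -/
noncomputable def threshold : ℝ := 18 * η / S.ε * (η + S.ε) * γ * S.α * S.c * P.L

open Classical in
/-- The probability that the conservative phase entered at `τ` ends in period `t`. -/
noncomputable def switchProb (τ t : ℕ) (x : ∀ i, A i) : ℝ :=
  if γ ≤ S.optEstimate e τ t x then (S.monteCarlo e τ t x).real {s | S.threshold ≤ s} else 0

theorem switchProb_nonneg (τ t : ℕ) (x : ∀ i, A i) : 0 ≤ S.switchProb e τ t x := by
  unfold switchProb
  split_ifs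
  exacts [measureReal_nonneg, le_rfl]

theorem switchProb_le_one (τ t : ℕ) (x : ∀ i, A i) : S.switchProb e τ t x ≤ 1 := by
  unfold switchProb
  split_ifs
  exacts [measureReal_le_one, zero_le_one]

theorem optEstimate_congr {τ t : ℕ} {x x' : ∀ i, A i} (h : pre x τ = pre x' τ) :
    S.optEstimate e τ t x = S.optEstimate e τ t x' := by
  rw [optEstimate, optEstimate, offlineSeq, offlineSeq, h, splice_congr_left _ h]

/-- Both tests restart from the history at the beginning of the phase, so the actions actually
executed during the phase do not influence the exit probability. -/
theorem switchProb_congr {τ k : ℕ} {x x' : ∀ i, A i} (h : pre x τ = pre x' τ) :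
    S.switchProb e τ (τ + k) x = S.switchProb e τ (τ + k) x' := by
  rw [switchProb, switchProb, S.optEstimate_congr e h, S.monteCarlo_congr e h]

/-! ### Recursions for the cost-to-go. -/

variable [∀ t, MetricSpace (E t)]

/-- The expected cost of the `j` periods from period `t` on, as a function of the state of the
algorithm at the beginning of period `t`. -/
noncomputable def costToGo : ℕ → ℕ → State A → ℝ
  | 0, _ => fun _ => 0
  | j + 1, t => fun z => ∫ z', (P.costAt t e z'.2.2 + costToGo j (t + 1) z') ∂(S.step e t z)

theorem measurable_costToGo (j t : ℕ) : Measurable (S.costToGo e j t) := by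
  induction j generalizing t with
  | zero => exact measurable_const
  | succ j ih =>
    exact measurable_integral_kernel (S.step e t)
      (((P.measurable_costAt t e).comp (measurable_snd.comp measurable_snd)).add (ih (t + 1)))

theorem abs_costToGo_le (j t : ℕ) (z : State A) : |S.costToGo e j t z| ≤ j * P.L := by
  induction j generalizing t z with
  | zero => simp [costToGo]
  | succ j ih =>
    refine abs_integral_le_of_abs_le fun z' => (abs_add_le _ _).trans ?_
    have h1 := PolicyClass.abs_costAt_le e P t z'.2.2
    have h2 := ih (t + 1) z'
    push_cast
    linarith

theorem measurable_stageCost (j t : ℕ) :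
    Measurable fun z : State A => P.costAt t e z.2.2 + S.costToGo e j (t + 1) z :=
  ((P.measurable_costAt t e).comp (measurable_snd.comp measurable_snd)).add
    (S.measurable_costToGo e j (t + 1))

theorem abs_stageCost_le (j t : ℕ) (z : State A) :
    |P.costAt t e z.2.2 + S.costToGo e j (t + 1) z| ≤ (j + 1) * P.L := by
  refine (abs_add_le _ _).trans ?_
  have h1 := PolicyClass.abs_costAt_le e P t z.2.2
  have h2 := S.abs_costToGo_le e j (t + 1) z
  linarith

theorem costToGo_predictive (j t σ : ℕ) (τp : ℕ∞) (p : (∀ i, A i) × (∀ i, A i)) :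
    S.costToGo e (j + 1) t (Mode.predictive σ τp, p) =
      P.costAt t e (S.predictiveUpdate e σ τp t p).2.2 +
        S.costToGo e j (t + 1) (S.predictiveUpdate e σ τp t p) := by
  change ∫ z', _ ∂(Measure.dirac (S.predictiveUpdate e σ τp t p)) = _
  rw [integral_dirac' _ _ (S.measurable_stageCost e j t).stronglyMeasurable]

/-- Given the history, the action and the Monte Carlo estimate are independent, so the integral over
the estimate only produces the weights of the two successor modes. -/
theorem costToGo_conservative (j t τ : ℕ) (plan x : ∀ i, A i) :
    S.costToGo e (j + 1) t (Mode.conservative τ, plan, x) =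
      ∫ a, (P.costAt t e (Function.update x t a) +
        (S.switchProb e τ t x * S.costToGo e j (t + 1)
            (Mode.predictive (t + 1) (t + 1 : ℕ), plan, Function.update x t a) +
          (1 - S.switchProb e τ t x) * S.costToGo e j (t + 1)
            (Mode.conservative τ, plan, Function.update x t a))) ∂(S.online.act e τ t x) := by
  classical
  set F : State A → ℝ := fun z => P.costAt t e z.2.2 + S.costToGo e j (t + 1) z with hF
  have hFm : Measurable F := S.measurable_stageCost e j t
  have hFb : ∀ z, |F z| ≤ (j + 1) * P.L := S.abs_stageCost_le e j t
  have hFu : Measurable fun p => F (S.conservativeUpdate e τ t p) :=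
    hFm.comp (S.measurable_conservativeUpdate e τ t)
  change ∫ z', F z' ∂(S.conservativeStep e τ t (plan, x)) = _
  rw [conservativeStep, Kernel.map_apply _ (S.measurable_conservativeUpdate e τ t),
    integral_map (S.measurable_conservativeUpdate e τ t).aemeasurable hFm.aestronglyMeasurable,
    Kernel.prod_apply, Kernel.id_apply, Measure.dirac_prod,
    integral_map (by fun_prop) hFu.aestronglyMeasurable,
    Kernel.comap_apply, Kernel.prod_apply]
  have hFx : Measurable fun r : A t × ℝ => F (S.conservativeUpdate e τ t ((plan, x), r)) :=
    hFu.comp measurable_prodMk_left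
  rw [integral_prod _ (integrable_of_abs_le (C := (j + 1) * P.L) hFx fun z => hFb _)]
  refine integral_congr_ae (Filter.Eventually.of_forall fun a => ?_)
  set zp : State A := (Mode.predictive (t + 1) (t + 1 : ℕ), plan, Function.update x t a) with hzp
  set zc : State A := (Mode.conservative τ, plan, Function.update x t a) with hzc
  have hupd : ∀ s : ℝ, F (S.conservativeUpdate e τ t ((plan, x), (a, s))) =
      if γ ≤ S.optEstimate e τ t x then
        F zc + Set.indicator {s : ℝ | S.threshold ≤ s} 1 s * (F zp - F zc) else F zc := by
    intro s
    by_cases h1 : γ ≤ S.optEstimate e τ t x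
    · by_cases h2 : S.threshold ≤ s
      · have h2' := h2
        rw [threshold] at h2'
        simp [conservativeUpdate, h1, h2, h2', hzp]
      · have h2' := h2
        rw [threshold] at h2'
        simp [conservativeUpdate, h1, h2, h2', hzc]
    · simp [conservativeUpdate, h1, hzc]
  have hmeas : MeasurableSet {s : ℝ | S.threshold ≤ s} := measurableSet_Ici
  have hint : ∫ s, F (S.conservativeUpdate e τ t ((plan, x), (a, s))) ∂(S.monteCarlo e τ t x) =
      F zc + S.switchProb e τ t x * (F zp - F zc) := by
    simp only [hupd, switchProb]
    split_ifs with h1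
    · rw [integral_add (integrable_const _), integral_mul_const, integral_indicator_one hmeas]
      · simp
      · exact ((integrable_const (1 : ℝ)).indicator hmeas).mul_const _
    · simp
  refine hint.trans ?_
  simp only [hF, hzp, hzc]
  ring

/-- The expected cost-to-go after `k` periods of a conservative phase entered at `τ`, given that the
phase has not ended. -/
noncomputable def phaseValue (τ : ℕ) (plan x : ∀ i, A i) (j k : ℕ) : ℝ :=
  ∫ y, S.costToGo e j (τ + k) (Mode.conservative τ, plan, y) ∂(S.online.rollout e τ k x)

/-- The expected cost-to-go after `k` periods of a conservative phase entered at `τ`, given that the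
phase has just ended. -/
noncomputable def exitValue (τ : ℕ) (plan x : ∀ i, A i) (j k : ℕ) : ℝ :=
  ∫ y, S.costToGo e j (τ + k) (Mode.predictive (τ + k) (τ + k : ℕ), plan, y)
    ∂(S.online.rollout e τ k x)

theorem measurable_costToGo_mode (j t : ℕ) (z : Mode) (plan : ∀ i, A i) :
    Measurable fun y => S.costToGo e j t (z, plan, y) :=
  (S.measurable_costToGo e j t).comp
    (measurable_const.prodMk (measurable_const.prodMk measurable_id))

theorem phaseValue_zero (τ : ℕ) (plan x : ∀ i, A i) (j : ℕ) :
    S.phaseValue e τ plan x j 0 = S.costToGo e j τ (Mode.conservative τ, plan, x) := by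
  rw [phaseValue, PolicyClass.rollout, Kernel.id_apply,
    integral_dirac' _ _ (S.measurable_costToGo_mode e j _ _ plan).stronglyMeasurable]
  rfl

/-- Since exits do not depend on the actions of the phase, conditioning on survival leaves the
rollout law unchanged. The mean cost accumulated so far is added on both sides to match the scalar
recursion of `stoppedPhase_le_mul`. -/
theorem phaseValue_succ (τ : ℕ) (plan x : ∀ i, A i) (j k : ℕ) :
    S.onlineMean e τ x k + S.phaseValue e τ plan x (j + 1) k =
      S.switchProb e τ (τ + k) x *
          (S.onlineMean e τ x (k + 1) + S.exitValue e τ plan x j (k + 1)) +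
        (1 - S.switchProb e τ (τ + k) x) *
          (S.onlineMean e τ x (k + 1) + S.phaseValue e τ plan x j (k + 1)) := by
  set q := S.switchProb e τ (τ + k) x with hq
  set Wp : (∀ i, A i) → ℝ := fun y => S.costToGo e j (τ + k + 1)
    (Mode.predictive (τ + k + 1) (τ + k + 1 : ℕ), plan, y) with hWp
  set Wc : (∀ i, A i) → ℝ := fun y => S.costToGo e j (τ + k + 1)
    (Mode.conservative τ, plan, y) with hWc
  have hWpm : Measurable Wp := S.measurable_costToGo_mode e _ _ _ plan
  have hWcm : Measurable Wc := S.measurable_costToGo_mode e _ _ _ plan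
  have hWpb : ∀ y, |Wp y| ≤ j * P.L := fun y => S.abs_costToGo_le e _ _ _
  have hWcb : ∀ y, |Wc y| ≤ j * P.L := fun y => S.abs_costToGo_le e _ _ _
  set Ψ : (∀ i, A i) → ℝ := fun y => P.costAt (τ + k) e y + (q * Wp y + (1 - q) * Wc y) with hΨ
  have hΨm : Measurable Ψ :=
    (P.measurable_costAt _ e).add ((hWpm.const_mul _).add (hWcm.const_mul _))
  have hq0 : 0 ≤ q := S.switchProb_nonneg e _ _ _
  have hq1 : q ≤ 1 := S.switchProb_le_one e _ _ _
  have hΨb : ∀ y, |Ψ y| ≤ P.L + (j * P.L + j * P.L) := by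
    intro y
    refine (abs_add_le _ _).trans (add_le_add (PolicyClass.abs_costAt_le e P _ y)
      ((abs_add_le _ _).trans (add_le_add ?_ ?_)))
    · rw [abs_mul, abs_of_nonneg hq0]
      exact (mul_le_of_le_one_left (abs_nonneg _) hq1).trans (hWpb y)
    · rw [abs_mul, abs_of_nonneg (sub_nonneg.2 hq1)]
      exact (mul_le_of_le_one_left (abs_nonneg _) (by linarith)).trans (hWcb y)
  have h1 : S.phaseValue e τ plan x (j + 1) k =
      ∫ y, Ψ y ∂(S.online.rollout e τ (k + 1) x) := by
    -- Passing to `splice τ x y` under both integrals restores the prefix of `x`, so the exit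
    -- probability inside the integral is the constant `q`.
    rw [S.online.integral_rollout_succ e τ k x hΨm hΨb, phaseValue,
      ← S.online.integral_rollout_splice e τ k x (S.measurable_costToGo_mode e _ _ _ plan),
      ← S.online.integral_rollout_splice e τ k x (S.online.measurable_integral_act e τ (τ + k) hΨm)]
    refine integral_congr_ae (Filter.Eventually.of_forall fun y => ?_)
    simp only
    rw [costToGo_conservative, S.switchProb_congr e (pre_splice τ x y)]
  have hi1 : Integrable (P.costAt (τ + k) e) (S.online.rollout e τ (k + 1) x) :=
    integrable_of_abs_le (P.measurable_costAt _ e) (PolicyClass.abs_costAt_le e P _)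
  have hi2 : Integrable Wp (S.online.rollout e τ (k + 1) x) := integrable_of_abs_le hWpm hWpb
  have hi3 : Integrable Wc (S.online.rollout e τ (k + 1) x) := integrable_of_abs_le hWcm hWcb
  have h2 : S.exitValue e τ plan x j (k + 1) = ∫ y, Wp y ∂(S.online.rollout e τ (k + 1) x) := rfl
  have h3 : S.phaseValue e τ plan x j (k + 1) = ∫ y, Wc y ∂(S.online.rollout e τ (k + 1) x) := rfl
  have h4 : ∫ y, Ψ y ∂(S.online.rollout e τ (k + 1) x) =
      ∫ y, P.costAt (τ + k) e y ∂(S.online.rollout e τ (k + 1) x) +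
        (q * ∫ y, Wp y ∂(S.online.rollout e τ (k + 1) x) +
          (1 - q) * ∫ y, Wc y ∂(S.online.rollout e τ (k + 1) x)) := by
    rw [← integral_const_mul, ← integral_const_mul,
      ← integral_add (hi2.const_mul q) (hi3.const_mul (1 - q))]
    exact integral_add hi1 ((hi2.const_mul q).add (hi3.const_mul (1 - q)))
  rw [h1, h2, h3, h4, onlineMean_succ]
  ring

theorem exitValue_le (τ : ℕ) (plan x : ∀ i, A i) (j k : ℕ) {C : ℝ}
    (h : ∀ y, S.costToGo e j (τ + k) (Mode.predictive (τ + k) (τ + k : ℕ), plan, y) ≤ C) :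
    S.exitValue e τ plan x j k ≤ C := by
  refine (integral_mono (integrable_of_abs_le (S.measurable_costToGo_mode e _ _ _ plan)
    fun y => S.abs_costToGo_le e _ _ _) (integrable_const C) h).trans ?_
  simp

variable [∀ t, Nonempty (A t)]

/-- Periods from `N` on cost nothing. For the others, the cost of the first `n` periods plus the
expected cost-to-go after them does not depend on `n`. -/
theorem expectedCost_eq_costToGo {N : ℕ} (hN : P.effLen e ≤ N) :
    S.expectedCost e = S.costToGo e N 0
      (Mode.conservative 0, (fun _ => Classical.arbitrary _), fun _ => Classical.arbitrary _) := by
  have hsum : S.expectedCost e =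
      ∑ t ∈ Finset.range N, ∫ z, P.costAt t e z.2.2 ∂(S.law e (t + 1)) := by
    rw [expectedCost, tsum_eq_sum (s := Finset.range N)]
    intro t ht
    have : (N : ℕ∞) ≤ t := by exact_mod_cast not_lt.1 (by simpa using ht)
    simp [CostProblem.costAt_eq_zero_of_effLen_le (hN.trans this)]
  have hstep : ∀ t j, ∫ z, S.costToGo e (j + 1) t z ∂(S.law e t) =
      ∫ z, P.costAt t e z.2.2 ∂(S.law e (t + 1)) +
        ∫ z, S.costToGo e j (t + 1) z ∂(S.law e (t + 1)) := by
    intro t j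
    rw [← integral_add, law, integral_bind_kernel _ _ (S.measurable_stageCost e j t)
      (S.abs_stageCost_le e j t)]
    · rfl
    · exact integrable_of_abs_le ((P.measurable_costAt t e).comp
        (measurable_snd.comp measurable_snd)) fun z => PolicyClass.abs_costAt_le e P t z.2.2
    · exact integrable_of_abs_le (S.measurable_costToGo e j (t + 1)) (S.abs_costToGo_le e j (t + 1))
  have htel : ∀ n ≤ N, ∑ t ∈ Finset.range n, ∫ z, P.costAt t e z.2.2 ∂(S.law e (t + 1)) +
      ∫ z, S.costToGo e (N - n) n z ∂(S.law e n) = ∫ z, S.costToGo e N 0 z ∂(S.law e 0) := by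
    intro n
    induction n with
    | zero => simp
    | succ n ih =>
      intro hn
      rw [← ih (by omega), Finset.sum_range_succ, add_assoc, ← hstep,
        show N - (n + 1) + 1 = N - n by omega]
  have h := htel N le_rfl
  rw [Nat.sub_self, law, integral_dirac' _ _ (S.measurable_costToGo e N 0).stronglyMeasurable] at h
  simpa [hsum, costToGo] using h

end Input

/-! ### Batches: predicted cost, actual cost, and comparison with `a`. -/

namespace Input

variable {P : CostProblem E A} {γ η f : ℝ} (S : Input P γ η f) (e : ∀ i, E i)

section Batch

theorem pre_offlineSeq (m n : ℕ) (x : ∀ i, A i) : pre (S.offlineSeq m n e x) m = pre x m :=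
  pre_splice _ _ _

theorem pre_batchSeq (t : ℕ) (x : ∀ i, A i) : pre (S.batchSeq e t x) t = pre x t :=
  S.pre_offlineSeq _ _ _ _

theorem batchEnd_spec (t : ℕ) (x : ∀ i, A i) : S.BatchStop e t x (S.batchEnd e t x) := by
  classical
  exact Nat.find_spec (S.exists_batchStop e t x)

theorem le_batchEnd (t : ℕ) (x : ∀ i, A i) : t ≤ S.batchEnd e t x := (S.batchEnd_spec e t x).1

theorem val_lt_of_lt_batchEnd {t m : ℕ} {x : ∀ i, A i} (htm : t ≤ m) (hm : m < S.batchEnd e t x) :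
    P.val t m (S.forecast e t) (S.offlineSeq t m (S.forecast e t) x) < S.α * S.c * P.L := by
  classical
  by_contra h
  exact Nat.find_min (S.exists_batchStop e t x) hm ⟨htm, Or.inr (not_lt.1 h)⟩

theorem pre_forecast (t : ℕ) : pre (S.forecast e t) (t + 1) = pre e (t + 1) := pre_splice _ _ _

/-- The predicted cost of the batch that begins at period `t`. -/
noncomputable def batchCost (t : ℕ) (x : ∀ i, A i) : ℝ :=
  P.val t (S.batchEnd e t x) (S.forecast e t) (S.batchSeq e t x)

theorem nextBatch_eq_top_or (t : ℕ) (x : ∀ i, A i) :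
    (S.nextBatch e t x = ⊤ ∧ S.batchCost e t x < S.α * S.c * P.L) ∨
      (S.nextBatch e t x = S.batchEnd e t x ∧ S.α * S.c * P.L ≤ S.batchCost e t x) := by
  unfold nextBatch
  split_ifs with h
  · exact Or.inl ⟨rfl, h⟩
  · exact Or.inr ⟨rfl, not_lt.1 h⟩

/-- The search may stop at once with `batchEnd = t`, but an empty batch costs `0`, below the
threshold, and is then extended to infinity. Every batch therefore makes progress. -/
theorem lt_nextBatch (hK : 0 < S.α * S.c * P.L) (t : ℕ) (x : ∀ i, A i) :
    (t : ℕ∞) < S.nextBatch e t x := by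
  rcases S.nextBatch_eq_top_or e t x with ⟨h, -⟩ | ⟨h, h'⟩
  · rw [h]
    exact ENat.natCast_lt_top t
  · rw [h]
    have h1 := S.le_batchEnd e t x
    rcases h1.lt_or_eq with h2 | h2
    · exact_mod_cast h2
    · rw [batchCost, ← h2, P.val_self] at h'
      linarith

variable (hStar : P.IsFinite S.eStar)

include hStar

theorem isFinite_forecast (t : ℕ) : P.IsFinite (S.forecast e t) := hStar.splice _ _

theorem batchCost_le_opt (t : ℕ) (x : ∀ i, A i) (h : t < S.batchEnd e t x) :
    S.batchCost e t x ≤ γ * P.opt t (S.batchEnd e t x) (S.forecast e t) x :=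
  S.offline.le t (S.batchEnd e t x) (S.forecast e t) x h (S.isFinite_forecast e hStar t)

/-- One period before the end the oracle's solution was still below the threshold. Extending it by
one arbitrary action costs at most `L` and bounds the optimum of the batch. -/
theorem batchCost_le (hγ : 0 ≤ γ) (hK : 0 ≤ S.α * S.c * P.L) (t : ℕ) (x : ∀ i, A i) :
    S.batchCost e t x ≤ γ * (S.α * S.c * P.L + P.L) := by
  have hL := P.L_nonneg e x
  rcases (S.le_batchEnd e t x).lt_or_eq with h | h
  · obtain ⟨m, hm⟩ : ∃ m, S.batchEnd e t x = m + 1 := ⟨S.batchEnd e t x - 1, by omega⟩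
    have h1 := S.batchCost_le_opt e hStar t x h
    have h2 := S.val_lt_of_lt_batchEnd (e := e) (x := x) (t := t) (m := m) (by omega) (by omega)
    have h3 : P.opt t (S.batchEnd e t x) (S.forecast e t) x ≤
        P.val t (m + 1 : ℕ) (S.forecast e t) (S.offlineSeq t m (S.forecast e t) x) := by
      rw [hm]
      exact P.opt_le_val _ _ _ _ _
    rw [P.val_succ (by omega)] at h3
    have h4 := P.costAt_le m (S.forecast e t) (S.offlineSeq t m (S.forecast e t) x)
    exact h1.trans (mul_le_mul_of_nonneg_left (by linarith) hγ)
  · rw [batchCost, ← h, P.val_self]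
    positivity

/-- If the batch is endless, the search was ended by the length estimator, so the forecast has no
cost beyond `batchEnd` whatever the arbitrary actions are. -/
theorem val_forecast_le_batchCost (t : ℕ) (x : ∀ i, A i) {q : ℕ}
    (hq : (q : ℕ∞) ≤ S.nextBatch e t x) :
    P.val t q (S.forecast e t) (S.batchSeq e t x) ≤ S.batchCost e t x := by
  rcases S.nextBatch_eq_top_or e t x with ⟨-, h⟩ | ⟨h, -⟩
  · rcases (S.batchEnd_spec e t x).2 with h1 | h1
    · have h2 : P.effLen (S.forecast e t) ≤ S.batchEnd e t x :=
        (S.estimator.le_est (t + 1) e S.eStar hStar).trans (by exact_mod_cast h1)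
      rw [batchCost]
      rcases le_total q (S.batchEnd e t x) with h3 | h3
      · exact P.val_mono h3 _ _
      · exact (CostProblem.val_eq_of_effLen_le h2 h3 _).le
    · exact absurd h1 (not_le.2 h)
  · rw [h] at hq
    exact P.val_mono (by exact_mod_cast hq) _ _

end Batch

variable [∀ t, MetricSpace (E t)]

/-- The prediction error of the periods `m, …, n-1`, truncated at `c / b` in each period. -/
noncomputable def errorSum (m n : ℕ) : ℝ :=
  ∑ i ∈ Finset.Ico m n, min (dist (e i) (S.eStar i)) (S.c / S.b)

theorem error_eq_errorSum (σ t : ℕ) : S.error e σ t = S.errorSum e σ (t + 1) := rfl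

/-- The competitive ratio of an endless predictive phase with a perfect prediction. -/
noncomputable def ratio : ℝ := γ + γ ^ 2 / (S.α - γ)

/-- The assumptions on the problem and the parameters under which the guarantees hold. -/
structure Admissible (u v : ℝ) : Prop where
  lip : P.StronglyLipschitz u v
  influence : P.BoundedInfluence f
  one_le_γ : 1 ≤ γ
  one_le_η : 1 ≤ η
  ε_pos : 0 < S.ε
  b_eq : S.b = u
  c_eq : S.c = max v f
  le_α : 16 * γ ≤ S.α
  one_le_b : 1 ≤ S.b
  b_le_c : S.b ≤ S.c
  one_le_H : 1 ≤ S.H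
  finite_eStar : P.IsFinite S.eStar
  finite_e : P.IsFinite e
  L_pos : 0 < P.L

variable {S e} {u v : ℝ}

namespace Admissible

variable (h : S.Admissible e u v)

include h

theorem one_le_c : 1 ≤ S.c := h.one_le_b.trans h.b_le_c

theorem α_pos : 0 < S.α := by linarith [h.le_α, h.one_le_γ]

theorem K_pos : 0 < S.α * S.c * P.L :=
  mul_pos (mul_pos h.α_pos (by linarith [h.one_le_c])) h.L_pos

theorem influence_le : f * P.L ≤ S.c * P.L :=
  mul_le_mul_of_nonneg_right (by rw [h.c_eq]; exact le_max_right _ _) h.L_pos.le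

theorem term_nonneg (i : ℕ) : 0 ≤ min (dist (e i) (S.eStar i)) (S.c / S.b) :=
  le_min dist_nonneg (div_nonneg (by linarith [h.one_le_c]) (by linarith [h.one_le_b]))

theorem errorSum_nonneg (m n : ℕ) : 0 ≤ S.errorSum e m n :=
  Finset.sum_nonneg fun i _ => h.term_nonneg i

theorem errorSum_mono {m n k : ℕ} (hnk : n ≤ k) : S.errorSum e m n ≤ S.errorSum e m k :=
  Finset.sum_le_sum_of_subset_of_nonneg (Finset.Ico_subset_Ico_right hnk)
    fun i _ _ => h.term_nonneg i

omit h in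
theorem errorSum_add {m n k : ℕ} (h1 : m ≤ n) (h2 : n ≤ k) :
    S.errorSum e m n + S.errorSum e n k = S.errorSum e m k :=
  Finset.sum_Ico_consecutive _ h1 h2

theorem γ_le_ratio : γ ≤ S.ratio := by
  have : 0 < S.α - γ := by linarith [h.le_α, h.one_le_γ]
  exact le_add_of_nonneg_right (by positivity)

theorem ratio_le : S.ratio ≤ 16 / 15 * γ := by
  have h1 : 0 < S.α - γ := by linarith [h.le_α, h.one_le_γ]
  have h2 : γ ^ 2 / (S.α - γ) ≤ γ / 15 := by
    rw [div_le_div_iff₀ h1 (by norm_num)]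
    nlinarith [h.le_α, h.one_le_γ]
  unfold ratio
  linarith

theorem LB_nonneg : 0 ≤ P.L * S.b := mul_nonneg h.L_pos.le (by linarith [h.one_le_b])

theorem abs_val_sub_forecast_le (t n : ℕ) (a : ∀ i, A i) :
    |P.val t n e a - P.val t n (S.forecast e t) a| ≤ P.L * S.b * S.errorSum e t n := by
  have hb0 : 0 < S.b := by linarith [h.one_le_b]
  refine (h.lip.abs_val_sub_val_le h.b_eq hb0 (c := S.c) (by rw [h.c_eq]; exact le_max_left _ _)
    h.finite_e (m := t) (n := n) (pre_eq_of_le (S.pre_forecast e t).symm (Nat.le_succ t)) a).trans ?_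
  refine mul_le_mul_of_nonneg_left (Finset.sum_le_sum fun i _ => ?_) h.LB_nonneg
  by_cases hi : i < t + 1
  · rw [forecast, splice_of_lt _ _ hi, dist_self]
    exact (min_le_left _ _).trans (h.term_nonneg i)
  · rw [forecast, splice_of_le _ _ (not_lt.1 hi)]

theorem val_batchSeq_le (t : ℕ) (x : ∀ i, A i) {q : ℕ} (hq : (q : ℕ∞) ≤ S.nextBatch e t x) :
    P.val t q e (S.batchSeq e t x) ≤ S.batchCost e t x + P.L * S.b * S.errorSum e t q := by
  have h1 := (abs_le.1 (h.abs_val_sub_forecast_le t q (S.batchSeq e t x))).2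
  have h2 := S.val_forecast_le_batchCost e h.finite_eStar t x hq
  linarith

/-- The oracle is `γ`-optimal for the forecast from the history `x`. Passing to the history of `a`
costs `c * L`, and passing to the true requests costs the error term. -/
theorem batchCost_le_compare (t : ℕ) (x a : ∀ i, A i) :
    S.batchCost e t x ≤ γ * (P.val t (S.batchEnd e t x) e a + S.c * P.L +
      P.L * S.b * S.errorSum e t (S.batchEnd e t x)) := by
  have hγ := h.one_le_γ
  rcases (S.le_batchEnd e t x).lt_or_eq with h1 | h1
  · refine (S.batchCost_le_opt e h.finite_eStar t x h1).trans
      (mul_le_mul_of_nonneg_left ?_ (by linarith))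
    have h2 := h.influence.opt_le (S.isFinite_forecast e h.finite_eStar t) h1 x a
    have h3 := (abs_le.1 (h.abs_val_sub_forecast_le t (S.batchEnd e t x) a)).1
    linarith [h.influence_le]
  · rw [batchCost, ← h1, P.val_self, P.val_self]
    have h2 := mul_nonneg h.LB_nonneg (h.errorSum_nonneg t t)
    have h3 : 0 < S.c * P.L := mul_pos (by linarith [h.one_le_c]) h.L_pos
    positivity

theorem val_completeBatch_le (t : ℕ) (x a : ∀ i, A i)
    (hn : S.nextBatch e t x = S.batchEnd e t x) (hK : S.α * S.c * P.L ≤ S.batchCost e t x) :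
    P.val t (S.batchEnd e t x) e (S.batchSeq e t x) ≤
      S.ratio * (P.val t (S.batchEnd e t x) e a +
        P.L * S.b * S.errorSum e t (S.batchEnd e t x)) +
        P.L * S.b * S.errorSum e t (S.batchEnd e t x) := by
  have h1 := h.val_batchSeq_le t x hn.ge
  have h2 := h.batchCost_le_compare t x a
  have hγ := h.one_le_γ
  have h3 : 0 < S.α - γ := by linarith [h.le_α]
  set X := P.val t (S.batchEnd e t x) e a + P.L * S.b * S.errorSum e t (S.batchEnd e t x) with hX
  -- The predicted cost is at least `α * c * L` and at most `γ * (X + c * L)`; solving for `c * L`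
  -- turns the additive influence into a factor.
  have h4 : S.c * P.L ≤ γ / (S.α - γ) * X := by
    rw [div_mul_eq_mul_div, le_div_iff₀ h3]
    nlinarith
  have h5 : S.ratio * X = γ * (X + γ / (S.α - γ) * X) := by
    unfold ratio
    ring
  have h6 := mul_le_mul_of_nonneg_left h4 (by linarith : 0 ≤ γ)
  rw [h5]
  nlinarith

/-- A batch cut short cannot be compared with `a` multiplicatively, so its whole predicted cost is
charged. -/
theorem val_truncatedBatch_le (t : ℕ) (x : ∀ i, A i) {q : ℕ}
    (hq : (q : ℕ∞) ≤ S.nextBatch e t x) :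
    P.val t q e (S.batchSeq e t x) ≤
      P.L * S.b * S.errorSum e t q + γ * ((S.α + 1) * (S.c * P.L)) := by
  have h1 := h.val_batchSeq_le t x hq
  have h2 := S.batchCost_le e h.finite_eStar (by linarith [h.one_le_γ]) h.K_pos.le t x
  have h3 : P.L ≤ S.c * P.L := le_mul_of_one_le_left h.L_pos.le h.one_le_c
  have h4 := mul_le_mul_of_nonneg_left h3 (by linarith [h.one_le_γ] : 0 ≤ γ)
  nlinarith

variable {N : ℕ} (hN : P.effLen e ≤ N) (hagree : ∀ i, N ≤ i → e i = S.eStar i)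

include hagree in
theorem errorSum_le_horizon (t n : ℕ) : S.errorSum e t n ≤ S.errorSum e t N := by
  rcases le_total n N with h1 | h1
  · exact h.errorSum_mono h1
  · refine (Finset.sum_subset (Finset.Ico_subset_Ico_right h1) fun i hi hi' => ?_).ge
    rw [Finset.mem_Ico] at hi hi'
    rw [hagree i (by omega), dist_self]
    exact min_eq_left (div_nonneg (by linarith [h.one_le_c]) (by linarith [h.one_le_b]))

omit h [∀ t, MetricSpace (E t)] in
include hN in
theorem val_le_horizon (t n : ℕ) (a : ∀ i, A i) : P.val t n e a ≤ P.val t N e a := by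
  rcases le_total n N with h1 | h1
  · exact P.val_mono h1 _ _
  · exact (CostProblem.val_eq_of_effLen_le hN h1 a).le

-- Here the batch need not reach the cost threshold before the horizon, so the influence `γ * c * L`
-- stays additive; this happens only once.
include hN hagree in
theorem val_lastBatch_le (t : ℕ) (x a : ∀ i, A i) (hq : (N : ℕ∞) ≤ S.nextBatch e t x) :
    P.val t N e (S.batchSeq e t x) ≤
      S.ratio * (P.val t N e a + P.L * S.b * S.errorSum e t N) +
        P.L * S.b * S.errorSum e t N + γ * (S.c * P.L) := by
  have h1 := h.val_batchSeq_le t x hq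
  have h2 := h.batchCost_le_compare t x a
  have h3 := val_le_horizon hN t (S.batchEnd e t x) a
  have h4 := mul_le_mul_of_nonneg_left (h.errorSum_le_horizon hagree t (S.batchEnd e t x))
    h.LB_nonneg
  have hγ := h.one_le_γ
  have h5 : 0 ≤ P.val t N e a + P.L * S.b * S.errorSum e t N :=
    add_nonneg (P.val_nonneg _ _ _ _) (mul_nonneg h.LB_nonneg (h.errorSum_nonneg _ _))
  have h6 := mul_le_mul_of_nonneg_right h.γ_le_ratio h5
  have h7 : γ * (P.val t (S.batchEnd e t x) e a + S.c * P.L +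
      P.L * S.b * S.errorSum e t (S.batchEnd e t x)) ≤
      γ * ((P.val t N e a + P.L * S.b * S.errorSum e t N) + S.c * P.L) :=
    mul_le_mul_of_nonneg_left (by linarith) (by linarith)
  linarith [mul_add γ (P.val t N e a + P.L * S.b * S.errorSum e t N) (S.c * P.L)]

end Admissible

end Input

/-! ### Dynamics and cost of a predictive phase. -/

theorem pre_update_succ {X : ℕ → Type*} {s : ℕ} {y plan : ∀ i, X i} (hy : pre y s = pre plan s) :
    pre (Function.update y s (plan s)) (s + 1) = pre plan (s + 1) := by
  refine pre_eq_pre_iff.2 fun i hi => ?_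
  rcases eq_or_ne i s with rfl | hne
  · simp
  · simpa [hne] using pre_eq_pre_iff.1 hy i (by omega)

namespace Input

variable {P : CostProblem E A} {γ η f : ℝ} (S : Input P γ η f) (e : ∀ i, E i)

/-- The threshold on the prediction error that ends a predictive phase. -/
noncomputable def errorLevel : ℝ := 5 * (η + S.ε) * S.α * S.c / S.b

variable [∀ t, MetricSpace (E t)]

section Dynamics

variable {S e} {σ s : ℕ} {τp : ℕ∞} {plan y : ∀ i, A i}

/-- A state about to compute a batch may be replaced by one already holding it, so that later
periods are governed by `costToGo_stay` and `costToGo_switch`. -/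
theorem costToGo_newBatch (j : ℕ) (plan₀ : ∀ i, A i) (hn : (s : ℕ∞) ≠ S.nextBatch e s y) :
    S.costToGo e (j + 1) s (Mode.predictive σ s, plan₀, y) =
      S.costToGo e (j + 1) s (Mode.predictive σ (S.nextBatch e s y), S.batchSeq e s y, y) := by
  rw [costToGo_predictive, costToGo_predictive]
  simp [predictiveUpdate, hn]

theorem costToGo_stay (j : ℕ) (hs : (s : ℕ∞) ≠ τp) (hy : pre y s = pre plan s)
    (herr : S.error e σ s < S.errorLevel) :
    S.costToGo e (j + 1) s (Mode.predictive σ τp, plan, y) =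
      P.costAt s e plan + S.costToGo e j (s + 1)
        (Mode.predictive σ τp, plan, Function.update y s (plan s)) := by
  rw [costToGo_predictive]
  have h2 : ¬ 5 * (η + S.ε) * S.α * S.c / S.b ≤ S.error e σ s := not_le.2 herr
  simp only [predictiveUpdate, if_neg hs, if_neg h2]
  rw [P.costAt_congr rfl (pre_update_succ hy)]

theorem costToGo_switch (j : ℕ) (hs : (s : ℕ∞) ≠ τp) (hy : pre y s = pre plan s)
    (herr : S.errorLevel ≤ S.error e σ s) :
    S.costToGo e (j + 1) s (Mode.predictive σ τp, plan, y) =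
      P.costAt s e plan + S.costToGo e j (s + 1)
        (Mode.conservative (s + 1), plan, Function.update y s (plan s)) := by
  rw [costToGo_predictive]
  have h2 : 5 * (η + S.ε) * S.α * S.c / S.b ≤ S.error e σ s := herr
  simp only [predictiveUpdate, if_neg hs, if_pos h2]
  rw [P.costAt_congr rfl (pre_update_succ hy)]

theorem costToGo_run (j k : ℕ) (hs : ((s + k : ℕ) : ℕ∞) ≤ τp) (hy : pre y s = pre plan s)
    (herr : ∀ i, s ≤ i → i < s + k → S.error e σ i < S.errorLevel) :
    ∃ y', pre y' (s + k) = pre plan (s + k) ∧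
      S.costToGo e (j + k) s (Mode.predictive σ τp, plan, y) =
        P.val s (s + k : ℕ) e plan +
          S.costToGo e j (s + k) (Mode.predictive σ τp, plan, y') := by
  induction k generalizing j with
  | zero => exact ⟨y, hy, by simp [CostProblem.val_coe]⟩
  | succ k ih =>
    have hlt : ((s + k : ℕ) : ℕ∞) < τp := lt_of_lt_of_le (by exact_mod_cast Nat.lt_succ_self _) hs
    obtain ⟨y', hy', h⟩ := ih (j + 1) hlt.le fun i h1 h2 => herr i h1 (by omega)
    refine ⟨Function.update y' (s + k) (plan (s + k)), pre_update_succ hy', ?_⟩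
    rw [← add_assoc s k 1, P.val_succ (Nat.le_add_right s k), add_assoc,
      ← costToGo_stay j hlt.ne hy' (herr _ (by omega) (by omega)), ← h]
    congr 1
    omega

end Dynamics

namespace Admissible

variable {S e} {u v : ℝ} (h : S.Admissible e u v) {N : ℕ} (hN : P.effLen e ≤ N)
  (hagree : ∀ i, N ≤ i → e i = S.eStar i)

include h hN hagree

/-- The cost of a predictive phase that is never left, from the beginning of a batch on. -/
theorem costToGo_predictive_le_of_stay (a : ∀ i, A i) {σ t : ℕ} (ht : t ≤ N)
    (herr : ∀ i, t ≤ i → i < N → S.error e σ i < S.errorLevel) (plan y : ∀ i, A i) :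
    S.costToGo e (N - t) t (Mode.predictive σ t, plan, y) ≤
      S.ratio * (P.val t N e a + P.L * S.b * S.errorSum e t N) +
        P.L * S.b * S.errorSum e t N + γ * (S.c * P.L) := by
  induction hd : N - t using Nat.strong_induction_on generalizing t plan y with
  | _ d ih =>
  have hγ := h.one_le_γ
  have hρ : 0 ≤ S.ratio := by linarith [h.γ_le_ratio]
  have hLB := h.LB_nonneg
  have hcL : 0 < S.c * P.L := mul_pos (by linarith [h.one_le_c]) h.L_pos
  rcases ht.eq_or_lt with rfl | ht
  · have h1 := P.val_nonneg t t e a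
    have h2 := h.errorSum_nonneg t t
    rw [Nat.sub_self] at hd
    subst hd
    rw [costToGo]
    positivity
  have hν := S.lt_nextBatch e h.K_pos t y
  obtain ⟨j, rfl⟩ : ∃ j, d = j + 1 := ⟨d - 1, by omega⟩
  rw [costToGo_newBatch j plan hν.ne]
  have hy : pre y t = pre (S.batchSeq e t y) t := (S.pre_batchSeq e t y).symm
  rcases le_or_gt (N : ℕ∞) (S.nextBatch e t y) with hq | hq
  · have h1 := h.val_lastBatch_le hN hagree t y a hq
    obtain ⟨k, rfl⟩ : ∃ k, N = t + k := ⟨N - t, by omega⟩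
    -- The current batch lasts to the horizon, so no period remains after it.
    obtain ⟨y', -, h2⟩ := costToGo_run (S := S) (e := e) 0 k hq hy herr
    have h3 : j + 1 = 0 + k := by omega
    rw [h3, h2]
    simpa [costToGo] using h1
  · rcases S.nextBatch_eq_top_or e t y with ⟨h1, -⟩ | ⟨h1, h1'⟩
    · rw [h1] at hq
      simp at hq
    have h2 := h.val_completeBatch_le t y a h1 h1'
    rw [h1] at hq hν ⊢
    set n := S.batchEnd e t y with hn
    have hnN : n < N := by exact_mod_cast hq
    have htn : t < n := by exact_mod_cast hν
    obtain ⟨y', -, h3⟩ := costToGo_run (S := S) (e := e) (σ := σ) (τp := n) (N - n) (n - t)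
      (by rw [Nat.add_sub_cancel' htn.le]) hy fun i hi hi' => herr i hi (by omega)
    have h4 := ih (N - n) (by omega) hnN.le (fun i hi hi' => herr i (by omega) hi')
      (S.batchSeq e t y) y' rfl
    have h5 : j + 1 = N - n + (n - t) := by omega
    rw [h5, h3]
    simp only [Nat.add_sub_cancel' htn.le]
    have h6 := P.val_add htn.le hnN.le e a
    have h7 : S.errorSum e t n + S.errorSum e n N = S.errorSum e t N :=
      errorSum_add htn.le hnN.le
    rw [← h6, ← h7]
    linarith

omit hN hagree in
/-- The cost of a predictive phase that is left in period `s`, from the beginning of a batch on. -/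
theorem costToGo_predictive_le_of_switch (a : ∀ i, A i) {σ t s : ℕ} (hts : t ≤ s) (hs : s < N)
    (herr : ∀ i, t ≤ i → i < s → S.error e σ i < S.errorLevel)
    (hswitch : S.errorLevel ≤ S.error e σ s) (plan y : ∀ i, A i) :
    ∃ plan' y', S.costToGo e (N - t) t (Mode.predictive σ t, plan, y) ≤
      S.ratio * (P.val t (s + 1 : ℕ) e a + P.L * S.b * S.errorSum e t (s + 1)) +
        P.L * S.b * S.errorSum e t (s + 1) + γ * ((S.α + 1) * (S.c * P.L)) +
        S.costToGo e (N - (s + 1)) (s + 1) (Mode.conservative (s + 1), plan', y') := by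
  induction hd : N - t using Nat.strong_induction_on generalizing t plan y with
  | _ d ih =>
  have hγ := h.one_le_γ
  have hρ : 0 ≤ S.ratio := by linarith [h.γ_le_ratio]
  have hLB := h.LB_nonneg
  have hν := S.lt_nextBatch e h.K_pos t y
  obtain ⟨j, rfl⟩ : ∃ j, d = j + 1 := ⟨d - 1, by omega⟩
  rw [costToGo_newBatch j plan hν.ne]
  have hy : pre y t = pre (S.batchSeq e t y) t := (S.pre_batchSeq e t y).symm
  -- Either the crossing period `s` lies inside the current batch, which is then cut, or the batch
  -- is completed and the induction resumes at its end.
  rcases lt_or_ge (s : ℕ∞) (S.nextBatch e t y) with hq | hq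
  · have hq' : ((s + 1 : ℕ) : ℕ∞) ≤ S.nextBatch e t y := by
      have := Order.add_one_le_of_lt hq
      exact_mod_cast this
    have h1 := h.val_truncatedBatch_le t y hq'
    obtain ⟨y', hy', h2⟩ := costToGo_run (S := S) (e := e) (σ := σ) (plan := S.batchSeq e t y)
      (τp := S.nextBatch e t y) (N - (s + 1) + 1) (s - t)
      (by rw [Nat.add_sub_cancel' hts]; exact hq.le) hy fun i hi hi' => herr i hi (by omega)
    rw [Nat.add_sub_cancel' hts] at hy'
    have h3 : j + 1 = N - (s + 1) + 1 + (s - t) := by omega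
    refine ⟨_, _, le_of_eq_of_le (b := _ + S.costToGo e (N - (s + 1)) (s + 1)
      (Mode.conservative (s + 1), S.batchSeq e t y,
        Function.update y' s (S.batchSeq e t y s))) ?_ (add_le_add (h1.trans ?_) le_rfl)⟩
    · rw [h3, h2]
      simp only [Nat.add_sub_cancel' hts]
      rw [costToGo_switch _ hq.ne hy' hswitch, ← add_assoc, ← P.val_succ hts]
    · have h4 : 0 ≤ S.ratio * (P.val t (s + 1 : ℕ) e a +
          P.L * S.b * S.errorSum e t (s + 1)) :=
        mul_nonneg hρ (add_nonneg (P.val_nonneg _ _ _ _)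
          (mul_nonneg hLB (h.errorSum_nonneg _ _)))
      linarith
  · rcases S.nextBatch_eq_top_or e t y with ⟨h1, -⟩ | ⟨h1, h1'⟩
    · rw [h1] at hq
      simp at hq
    have h2 := h.val_completeBatch_le t y a h1 h1'
    rw [h1] at hq hν ⊢
    set n := S.batchEnd e t y with hn
    have hnN : n ≤ s := by exact_mod_cast hq
    have htn : t < n := by exact_mod_cast hν
    obtain ⟨y', -, h3⟩ := costToGo_run (S := S) (e := e) (σ := σ) (τp := n) (N - n) (n - t)
      (by rw [Nat.add_sub_cancel' htn.le]) hy fun i hi hi' => herr i hi (by omega)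
    obtain ⟨plan'', y'', h4⟩ := ih (N - n) (by omega) hnN
      (fun i hi hi' => herr i (by omega) hi') (S.batchSeq e t y) y' rfl
    refine ⟨plan'', y'', ?_⟩
    have h5 : j + 1 = N - n + (n - t) := by omega
    rw [h5, h3]
    simp only [Nat.add_sub_cancel' htn.le]
    have h6 := P.val_add htn.le (by omega : n ≤ s + 1) e a
    have h7 : S.errorSum e t n + S.errorSum e n (s + 1) = S.errorSum e t (s + 1) :=
      errorSum_add htn.le (by omega)
    rw [← h6, ← h7]
    linarith

/-- A predictive phase either lasts forever, or it is left in a period `s` in which its prediction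
error crosses the threshold. -/
theorem costToGo_predictive_le (a : ∀ i, A i) {σ : ℕ} (hσ : σ ≤ N) (plan y : ∀ i, A i) :
    (S.costToGo e (N - σ) σ (Mode.predictive σ σ, plan, y) ≤
      S.ratio * (P.val σ N e a + P.L * S.b * S.errorSum e σ N) +
        P.L * S.b * S.errorSum e σ N + γ * (S.c * P.L) ∧
      S.errorSum e σ N ≤ S.errorLevel + S.c / S.b) ∨
    ∃ s, σ ≤ s ∧ s < N ∧ S.errorLevel ≤ S.errorSum e σ (s + 1) ∧
      S.errorSum e σ (s + 1) ≤ S.errorLevel + S.c / S.b ∧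
      ∃ plan' y', S.costToGo e (N - σ) σ (Mode.predictive σ σ, plan, y) ≤
      S.ratio * (P.val σ (s + 1 : ℕ) e a + P.L * S.b * S.errorSum e σ (s + 1)) +
        P.L * S.b * S.errorSum e σ (s + 1) + γ * ((S.α + 1) * (S.c * P.L)) +
        S.costToGo e (N - (s + 1)) (s + 1) (Mode.conservative (s + 1), plan', y') := by
  have hlevel : 0 ≤ S.errorLevel :=
    div_nonneg (mul_nonneg (mul_nonneg (by linarith [h.one_le_η, h.ε_pos]) h.α_pos.le)
      (by linarith [h.one_le_c])) (by linarith [h.one_le_b])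
  have hcb : 0 ≤ S.c / S.b := div_nonneg (by linarith [h.one_le_c]) (by linarith [h.one_le_b])
  -- The truncation of each error term bounds the overshoot over the level by `c / b`.
  have hstep : ∀ s, σ ≤ s → (∀ i, σ ≤ i → i < s → S.error e σ i < S.errorLevel) →
      S.errorSum e σ (s + 1) ≤ S.errorLevel + S.c / S.b := by
    intro s hs herr
    rw [errorSum, Finset.sum_Ico_succ_top hs]
    refine add_le_add ?_ (min_le_right _ _)
    rcases hs.eq_or_lt with rfl | hs
    · simpa using hlevel
    · have := herr (s - 1) (by omega) (by omega)
      rw [error_eq_errorSum, show s - 1 + 1 = s by omega] at this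
      exact this.le
  by_cases hex : ∃ s, σ ≤ s ∧ s < N ∧ S.errorLevel ≤ S.error e σ s
  · classical
    obtain ⟨h1, h2, h3⟩ := Nat.find_spec hex
    set s := Nat.find hex with hs
    have herr : ∀ i, σ ≤ i → i < s → S.error e σ i < S.errorLevel := by
      intro i hi hi'
      by_contra hc
      exact Nat.find_min hex hi' ⟨hi, by omega, not_lt.1 hc⟩
    exact Or.inr ⟨s, h1, h2, h3, hstep s h1 herr,
      h.costToGo_predictive_le_of_switch a h1 h2 herr h3 plan y⟩
  · push Not at hex
    refine Or.inl ⟨h.costToGo_predictive_le_of_stay hN hagree a hσ hex plan y, ?_⟩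
    rcases hσ.eq_or_lt with rfl | hσ
    · simp only [errorSum, Finset.Ico_self, Finset.sum_empty]
      positivity
    · have := hstep (N - 1) (by omega) fun i hi hi' => hex i hi (by omega)
      rwa [show N - 1 + 1 = N by omega] at this

end Admissible

end Input

/-! ### Scalar recursions with random stopping. -/

section StoppedPhase

variable {U μ h p : ℕ → ℝ} {K : ℕ} {L : ℝ}
  (hU : ∀ k < K, U k = p k * (μ (k + 1) + h (k + 1)) + (1 - p k) * U (k + 1))
  (hUK : U K = μ K) (hp0 : ∀ k, 0 ≤ p k) (hp1 : ∀ k, p k ≤ 1)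

include hU hUK hp0 hp1

/-- A phase that is stopped with probability `p k` in step `k`, at cost `h (k + 1)`, where early
stops (at a time when the accumulated cost `μ` is small) are rare: the total expected cost is
bounded by `(η + ε)` times the final value of a benchmark `o`. -/
theorem stoppedPhase_le_mul {o : ℕ → ℝ} {η ε T B : ℝ} (hη : 1 ≤ η) (hε : 0 < ε) (hL : 0 < L)
    (hT : 288 * L ≤ T) (hB0 : 0 ≤ B) (hB : B ≤ 2 / 3 * (ε / η) * T) (ho0 : 0 ≤ o 0)
    (ho : Monotone o) (hμ0 : ∀ k, 0 ≤ μ k) (hμ : ∀ k ≤ K, μ k ≤ η * o k)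
    (hh : ∀ k ≤ K, h k ≤ (η + ε) * (o K - o k) + B)
    (hrare : ∀ k < K, μ (k + 1) < 3 / 4 * T →
      p k ≤ L * μ (k + 1) / ((k + 1) ^ 4 * (T / 4) ^ 2)) :
    U 0 ≤ (η + ε) * o K := by
  -- A reserve that starts at `0`, stays below `ε / 10`, and grows in step `k` by `ε / 10 / ((k + 1)
  -- * (k + 2))`. These increments pay for premature stops.
  set r : ℕ → ℝ := fun k => ε / 10 * (1 - 1 / ((k : ℝ) + 1)) with hr
  have hT0 : 0 < T := by linarith
  have hη0 : 0 < η := by linarith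
  have ho' : ∀ k, 0 ≤ o k := fun k => ho0.trans (ho (Nat.zero_le k))
  have hr0 : ∀ k, 0 ≤ r k := by
    intro k
    have : 1 / ((k : ℝ) + 1) ≤ 1 := by
      rw [div_le_one (by positivity)]
      linarith [Nat.cast_nonneg (α := ℝ) k]
    exact mul_nonneg (by positivity) (by linarith)
  have hr1 : ∀ k, r k ≤ ε / 10 := by
    intro k
    have : 0 ≤ 1 / ((k : ℝ) + 1) := by positivity
    exact mul_le_of_le_one_right (by positivity) (by linarith)
  have hrs : ∀ k, r (k + 1) - r k = ε / 10 / (((k : ℝ) + 1) * (k + 2)) := by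
    intro k
    simp only [hr]
    push_cast
    field_simp
    ring
  have key : ∀ d k, k + d = K → U k ≤ (η + ε) * o K - r k * o k := by
    intro d
    induction d with
    | zero =>
      intro k hk
      obtain rfl : k = K := by omega
      rw [hUK]
      nlinarith [hμ k le_rfl, hr1 k, ho' k, mul_le_mul_of_nonneg_right (hr1 k) (ho' k)]
    | succ d ih =>
      intro k hk
      have ih' := ih (k + 1) (by omega)
      rw [hU k (by omega)]
      have hok := ho' (k + 1)
      have hh' := hh (k + 1) (by omega)
      have hμ' := hμ (k + 1) (by omega)
      have hmono : r k * o k ≤ r k * o (k + 1) :=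
        mul_le_mul_of_nonneg_left (ho (Nat.le_succ k)) (hr0 k)
      have hq : 0 ≤ 1 - p k := sub_nonneg.2 (hp1 k)
      have hrk : r k ≤ r (k + 1) := by
        have : 0 ≤ r (k + 1) - r k := by rw [hrs]; positivity
        linarith
      have hro := mul_le_mul_of_nonneg_right (hr1 (k + 1)) hok
      rcases lt_or_ge (μ (k + 1)) (3 / 4 * T) with hlow | hhigh
      -- Premature stop: its probability times the loss is at most `ε / 27 * o (k + 1) / (k + 1) ^
      -- 4`, where `1 / 27 = 32 / 3 / 288`. As `(k + 1) * (k + 2) ≤ 2 * (k + 1) ^ 4`, the increment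
      -- of the reserve suffices, by `2 / 27 < 1 / 10`.
      · have h1 : p k * B ≤ (r (k + 1) - r k) * o (k + 1) := by
          rw [hrs]
          have h2 := mul_le_mul (hrare k (by omega) hlow) hB hB0
            ((hp0 k).trans (hrare k (by omega) hlow))
          have h3 : L * μ (k + 1) / (((k : ℝ) + 1) ^ 4 * (T / 4) ^ 2) *
              (2 / 3 * (ε / η) * T) =
              32 / 3 * ε * (L / T) * (μ (k + 1) / η) / ((k : ℝ) + 1) ^ 4 := by
            field_simp
            ring
          have h4 : L / T ≤ 1 / 288 := by
            rw [div_le_div_iff₀ hT0 (by norm_num)]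
            linarith
          have h5 : μ (k + 1) / η ≤ o (k + 1) := by
            rw [div_le_iff₀ hη0]
            linarith
          have h5' : 0 ≤ μ (k + 1) / η := div_nonneg (hμ0 _) hη0.le
          have h6 : 32 / 3 * ε * (L / T) * (μ (k + 1) / η) ≤ 32 / 3 * ε * (1 / 288) * o (k + 1) := by
            gcongr
          have h7 : ((k : ℝ) + 1) * (k + 2) ≤ 2 * ((k : ℝ) + 1) ^ 4 := by
            have hk0 : (0 : ℝ) ≤ k := Nat.cast_nonneg k
            nlinarith [pow_nonneg hk0 2, pow_nonneg hk0 3, pow_nonneg hk0 4]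
          calc p k * B ≤ _ := h2
            _ = _ := h3
            _ ≤ 32 / 3 * ε * (1 / 288) * o (k + 1) / ((k : ℝ) + 1) ^ 4 := by gcongr
            _ ≤ 32 / 3 * ε * (1 / 288) * o (k + 1) / (((k : ℝ) + 1) * (k + 2) / 2) := by
              gcongr
              linarith
            _ = 2 / 27 * (ε / (((k : ℝ) + 1) * (k + 2)) * o (k + 1)) := by
              field_simp
              ring
            _ ≤ 1 / 10 * (ε / (((k : ℝ) + 1) * (k + 2)) * o (k + 1)) :=
              mul_le_mul_of_nonneg_right (by norm_num) (by positivity)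
            _ = _ := by ring
        have h2 : μ (k + 1) + h (k + 1) ≤ (η + ε) * o K - r (k + 1) * o (k + 1) + B := by
          nlinarith
        have h3 := mul_le_mul_of_nonneg_left h2 (hp0 k)
        have h4 := mul_le_mul_of_nonneg_left ih' hq
        linarith
      -- Timely stop: `T ≤ 4 / 3 * η * o (k + 1)` and `8 / 9 = 2 / 3 * 4 / 3`. The ninth of `ε * o
      -- (k + 1)` left over exceeds the reserve, which is at most a tenth.
      · have h1 : B ≤ 8 / 9 * (ε * o (k + 1)) := by
          have h2 : ε / η * T ≤ ε / η * (4 / 3 * (η * o (k + 1))) :=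
            mul_le_mul_of_nonneg_left (by linarith) (by positivity)
          have h3 : ε / η * (4 / 3 * (η * o (k + 1))) = 4 / 3 * (ε * o (k + 1)) := by
            field_simp
          rw [h3] at h2
          linarith
        have h2 : μ (k + 1) + h (k + 1) ≤ (η + ε) * o K - r (k + 1) * o (k + 1) := by
          have := mul_nonneg hε.le hok
          nlinarith
        have h3 := mul_le_mul_of_nonneg_left h2 (hp0 k)
        have h4 := mul_le_mul_of_nonneg_left ih' hq
        have h5 := mul_le_mul_of_nonneg_right hrk hok
        linarith
  have h0 := key K 0 (by omega)
  simpa [hr] using h0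

/-- A phase that is stopped with probability at least one half as soon as the accumulated cost
exceeds `Θ`. -/
theorem stoppedPhase_le_add {Θ W : ℝ} (hL : 0 ≤ L) (hW : 0 ≤ W)
    (hμmono : ∀ k, μ k ≤ μ (k + 1)) (hμ : ∀ k, μ (k + 1) ≤ μ k + L) (hh : ∀ k ≤ K, h k ≤ W)
    (hhalf : ∀ k < K, Θ < μ (k + 1) → 1 - p k ≤ 1 / 2) :
    U 0 ≤ W + max Θ (μ 0) + 2 * L := by
  -- Beyond `Θ` the number of further periods is dominated by a geometric variable of mean two, each
  -- costing at most `L`.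
  have key : ∀ d k, k + d = K → U k ≤ W + max Θ (μ k) + 2 * L := by
    intro d
    induction d with
    | zero =>
      intro k hk
      obtain rfl : k = K := by omega
      rw [hUK]
      linarith [le_max_right Θ (μ k)]
    | succ d ih =>
      intro k hk
      have ih' := ih (k + 1) (by omega)
      rw [hU k (by omega)]
      have hh' := hh (k + 1) (by omega)
      have hq : 0 ≤ 1 - p k := sub_nonneg.2 (hp1 k)
      have h1 : p k * (μ (k + 1) + h (k + 1)) ≤ p k * (μ (k + 1) + W) :=
        mul_le_mul_of_nonneg_left (by linarith) (hp0 k)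
      have h2 := mul_le_mul_of_nonneg_left ih' hq
      rcases le_or_gt (μ (k + 1)) Θ with hlow | hhigh
      · rw [max_eq_left hlow] at h2
        rw [max_eq_left ((hμmono k).trans hlow)]
        have h3 := mul_le_mul_of_nonneg_left hlow (hp0 k)
        have h4 := mul_nonneg (hp0 k) hL
        linarith
      · rw [max_eq_right hhigh.le] at h2
        have h3 := mul_le_mul_of_nonneg_right (hhalf k (by omega) hhigh) hL
        have h4 := hμ k
        have h5 := le_max_right Θ (μ k)
        linarith
  exact key K 0 (by omega)

end StoppedPhase

/-! ### Comparison of constants and bounds for the exit probabilities. -/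

namespace Input.Admissible

section Constants

variable {P : CostProblem E A} {γ η f : ℝ}

/-- The overhead caused by the influence of the history, which is absent in the first phase. -/
noncomputable def overhead (S : Input P γ η f) (τ : ℕ) : ℝ :=
  if τ = 0 then 0 else 2 * (S.c * P.L)

/-- The scale of the additive guarantees. -/
noncomputable def scale (S : Input P γ η f) : ℝ :=
  η * (η + S.ε) / S.ε * (γ * S.α * (S.c * P.L))

theorem threshold_eq (S : Input P γ η f) : S.threshold = 18 * scale S := by
  unfold threshold scale
  ring

end Constants

variable [∀ t, MetricSpace (E t)]

variable {P : CostProblem E A} {γ η f : ℝ} {S : Input P γ η f} {e : ∀ i, E i} {u v : ℝ}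
  (h : S.Admissible e u v)

include h

theorem L_le : P.L ≤ S.c * P.L := le_mul_of_one_le_left h.L_pos.le h.one_le_c

theorem overhead_nonneg (τ : ℕ) : 0 ≤ overhead S τ := by
  unfold overhead
  split_ifs
  exacts [le_rfl, by linarith [h.L_le, h.L_pos]]

theorem overhead_le (τ : ℕ) : overhead S τ ≤ 2 * (S.c * P.L) := by
  unfold overhead
  split_ifs
  exacts [by linarith [h.L_le, h.L_pos], le_rfl]

theorem one_le_factor : 1 ≤ (η + S.ε) / S.ε := by
  rw [one_le_div h.ε_pos]
  linarith [h.one_le_η]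

theorem η_le_factor : η ≤ η * (η + S.ε) / S.ε := by
  rw [mul_div_assoc]
  exact le_mul_of_one_le_right (by linarith [h.one_le_η]) h.one_le_factor

theorem unit_pos : 0 < γ * (S.c * P.L) :=
  mul_pos (by linarith [h.one_le_γ]) (by linarith [h.L_le, h.L_pos])

theorem unit_le : 16 * (γ * (S.c * P.L)) ≤ γ * S.α * (S.c * P.L) := by
  have h1 : 16 ≤ S.α := by linarith [h.le_α, h.one_le_γ]
  have h2 := mul_le_mul_of_nonneg_right h1 h.unit_pos.le
  linarith

theorem le_scale : 16 * (η * (γ * (S.c * P.L))) ≤ scale S := by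
  have h1 := h.η_le_factor
  have h2 := h.unit_le
  have h3 := h.unit_pos
  have hη := h.one_le_η
  unfold scale
  calc 16 * (η * (γ * (S.c * P.L))) = η * (16 * (γ * (S.c * P.L))) := by ring
    _ ≤ _ := mul_le_mul h1 h2 (by positivity) (by linarith)

theorem unit_le_scale : 16 * (γ * (S.c * P.L)) ≤ scale S := by
  have h1 := h.le_scale
  have h2 := le_mul_of_one_le_left h.unit_pos.le h.one_le_η
  linarith

theorem L_le_scale : 16 * P.L ≤ scale S := by
  have h1 := h.unit_le_scale
  have h2 : S.c * P.L ≤ γ * (S.c * P.L) :=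
    le_mul_of_one_le_left (by linarith [h.L_le, h.L_pos]) h.one_le_γ
  linarith [h.L_le]

/-- The online oracle compared with an arbitrary action sequence. -/
theorem onlineMean_le (a : ∀ i, A i) (τ k : ℕ) (x : ∀ i, A i) :
    S.onlineMean e τ x k ≤ η * (P.val τ (τ + k : ℕ) e a + overhead S τ) := by
  have hη := h.one_le_η
  have hη0 : 0 ≤ η := by linarith
  rcases Nat.eq_zero_or_pos k with rfl | hk
  · rw [onlineMean_zero]
    exact mul_nonneg hη0 (add_nonneg (P.val_nonneg _ _ _ _) (h.overhead_nonneg τ))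
  have hlt : τ < τ + k := by omega
  rw [onlineMean, ← PolicyClass.val_eq_integral]
  rcases Nat.eq_zero_or_pos τ with rfl | hτ
  · refine (S.online.le_zero _ e x (by exact_mod_cast hlt) h.finite_e).trans
      (mul_le_mul_of_nonneg_left ?_ hη0)
    have := P.opt_le_val 0 (0 + k : ℕ) e x a
    rw [splice_zero] at this
    simpa [overhead] using this
  · refine (S.online.le_pos τ _ e x hτ (by exact_mod_cast hlt) h.finite_e).trans
      (mul_le_mul_of_nonneg_left ?_ hη0)
    have h1 := h.influence.opt_le h.finite_e hlt x a
    have h2 := h.influence_le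
    simp only [overhead, if_neg hτ.ne']
    linarith

/-- Exiting while the mean is `δ` below the threshold forces the estimate to deviate by `δ`; the
second test can only lower the probability. -/
theorem switchProb_le (τ k : ℕ) (x : ∀ i, A i) {δ : ℝ} (hδ : 0 < δ)
    (hlow : S.onlineMean e τ x (k + 1) + δ ≤ S.threshold) :
    S.switchProb e τ (τ + k) x ≤
      P.L * S.onlineMean e τ x (k + 1) / ((k + 1) ^ 4 * δ ^ 2) := by
  have h1 := S.monteCarlo_deviation_le e h.one_le_H τ k x h.L_pos.le hδ
  refine le_trans ?_ h1
  unfold switchProb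
  split_ifs
  · refine measureReal_mono fun s hs => ?_
    have hs' : S.threshold ≤ s := hs
    have hdev : δ ≤ s - S.onlineMean e τ x (k + 1) := by linarith
    exact hdev.trans (le_abs_self _)
  · exact measureReal_nonneg

theorem one_sub_switchProb_le (τ k : ℕ) (x : ∀ i, A i) {δ : ℝ} (hδ : 0 < δ)
    (hhigh : S.threshold + δ ≤ S.onlineMean e τ x (k + 1))
    (hopt : γ ≤ S.optEstimate e τ (τ + k) x) :
    1 - S.switchProb e τ (τ + k) x ≤
      P.L * S.onlineMean e τ x (k + 1) / ((k + 1) ^ 4 * δ ^ 2) := by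
  have h1 := S.monteCarlo_deviation_le e h.one_le_H τ k x h.L_pos.le hδ
  refine le_trans ?_ h1
  have hmeas : MeasurableSet {s : ℝ | S.threshold ≤ s} := measurableSet_Ici
  rw [switchProb, if_pos hopt, ← probReal_compl_eq_one_sub hmeas]
  refine measureReal_mono fun s hs => ?_
  have hs' : s < S.threshold := not_le.1 hs
  have hdev : δ ≤ -(s - S.onlineMean e τ x (k + 1)) := by linarith
  exact hdev.trans (neg_le_abs _)

omit h in
theorem phaseValue_recursion {N τ : ℕ} (plan x : ∀ i, A i) (k : ℕ) (hk : k < N - τ) :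
    S.onlineMean e τ x k + S.phaseValue e τ plan x (N - τ - k) k =
      S.switchProb e τ (τ + k) x * (S.onlineMean e τ x (k + 1) +
        S.exitValue e τ plan x (N - (τ + (k + 1))) (k + 1)) +
      (1 - S.switchProb e τ (τ + k) x) * (S.onlineMean e τ x (k + 1) +
        S.phaseValue e τ plan x (N - τ - (k + 1)) (k + 1)) := by
  have h1 : N - τ - k = N - τ - (k + 1) + 1 := by omega
  have h2 : N - (τ + (k + 1)) = N - τ - (k + 1) := by omega
  rw [h1, h2, S.phaseValue_succ]

variable {N : ℕ} (hN : P.effLen e ≤ N) (hagree : ∀ i, N ≤ i → e i = S.eStar i) (a : ∀ i, A i)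

/-! ### The bound `η + ε`. -/

section Competitive

theorem costToGo_conservative_le_mul {τ : ℕ} (hτ : τ ≤ N)
    (hpred : ∀ σ, τ ≤ σ → σ ≤ N → ∀ plan y, S.costToGo e (N - σ) σ
      (Mode.predictive σ σ, plan, y) ≤
        (η + S.ε) * P.val σ N e a + 12 * ((η + S.ε) * (γ * S.α * (S.c * P.L))))
    (plan x : ∀ i, A i) :
    S.costToGo e (N - τ) τ (Mode.conservative τ, plan, x) ≤
      (η + S.ε) * (P.val τ N e a + overhead S τ) := by
  have hη := h.one_le_η
  have hε := h.ε_pos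
  have hunit := h.unit_le
  have hunit0 := h.unit_pos
  have key := stoppedPhase_le_mul (K := N - τ)
    (U := fun k => S.onlineMean e τ x k + S.phaseValue e τ plan x (N - τ - k) k)
    (μ := S.onlineMean e τ x)
    (h := fun k => S.exitValue e τ plan x (N - (τ + k)) k)
    (p := fun k => S.switchProb e τ (τ + k) x) (L := P.L)
    (o := fun k => P.val τ (τ + k : ℕ) e a + overhead S τ) (η := η) (ε := S.ε)
    (T := S.threshold) (B := 12 * ((η + S.ε) * (γ * S.α * (S.c * P.L))))
    (phaseValue_recursion plan x) (by simp [phaseValue, costToGo])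
    (fun k => S.switchProb_nonneg e _ _ _) (fun k => S.switchProb_le_one e _ _ _) hη hε h.L_pos
    -- `288 = 18 * 16`.
    (by rw [threshold_eq]; linarith [h.L_le_scale])
    (mul_nonneg (by norm_num) (mul_nonneg (by linarith) (by linarith)))
    (by
      -- The factor `18` of the threshold is calibrated for equality: `2 / 3 * 18 = 12`.
      refine le_of_eq ?_
      rw [threshold_eq, scale]
      field_simp
      ring)
    (add_nonneg (P.val_nonneg _ _ _ _) (h.overhead_nonneg τ))
    (fun i j hij => by
      have := P.val_mono (m := τ) (Nat.add_le_add_left hij τ) e a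
      simp only
      linarith)
    (S.onlineMean_nonneg e τ x) (fun k _ => h.onlineMean_le a τ k x)
    (fun k hk => ?_) (fun k hk hlow => ?_)
  · simp only [onlineMean_zero, zero_add, Nat.sub_zero, phaseValue_zero,
      Nat.add_sub_cancel' hτ] at key
    exact key
  · refine S.exitValue_le e τ plan x _ k fun y => (hpred (τ + k) (by omega) (by omega) plan y).trans
      (le_of_eq ?_)
    rw [Nat.add_sub_cancel' hτ, ← P.val_add (Nat.le_add_right τ k) (by omega : τ + k ≤ N) e a]
    ring
  · have hT : 0 < S.threshold := by
      rw [threshold_eq]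
      linarith [h.L_le_scale, h.L_pos]
    exact h.switchProb_le τ k x (by positivity) (by linarith)

include hN hagree

/-- In units of `X = (η + ε) * γ * α * c * L`, the prediction error costs at most `10.5`, the cut
batch `17 / 16`, and the overhead of the next conservative phase `1 / 8`; together less than `12`.
-/
theorem costToGo_predictive_le_mul (hρ : S.ratio ≤ η + S.ε) {σ : ℕ} (hσ : σ ≤ N)
    (hcons : ∀ τ, σ < τ → τ ≤ N → ∀ plan x, S.costToGo e (N - τ) τ
      (Mode.conservative τ, plan, x) ≤ (η + S.ε) * (P.val τ N e a + overhead S τ))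
    (plan y : ∀ i, A i) :
    S.costToGo e (N - σ) σ (Mode.predictive σ σ, plan, y) ≤
      (η + S.ε) * P.val σ N e a + 12 * ((η + S.ε) * (γ * S.α * (S.c * P.L))) := by
  have hη := h.one_le_η
  have hε := h.ε_pos
  have hγ := h.one_le_γ
  have hunit := h.unit_le
  have hunit0 := h.unit_pos
  have hsum : 1 ≤ η + S.ε := by linarith
  have hb0 : 0 < S.b := by linarith [h.one_le_b]
  have hcL : 0 < S.c * P.L := by linarith [h.L_le, h.L_pos]
  set X := (η + S.ε) * (γ * S.α * (S.c * P.L)) with hX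
  have hX1 : γ * S.α * (S.c * P.L) ≤ X := le_mul_of_one_le_left (by linarith) hsum
  have hX2 : 16 * ((η + S.ε) * (S.c * P.L)) ≤ X := by
    have h1 : S.c * P.L ≤ γ * (S.c * P.L) := le_mul_of_one_le_left hcL.le hγ
    have h2 := mul_le_mul_of_nonneg_left (by linarith : 16 * (S.c * P.L) ≤ γ * S.α * (S.c * P.L))
      (by linarith : 0 ≤ η + S.ε)
    linarith
  have herr : ∀ Φ, 0 ≤ Φ → Φ ≤ S.errorLevel + S.c / S.b → ∀ V, 0 ≤ V →
      S.ratio * (V + P.L * S.b * Φ) + P.L * S.b * Φ ≤ (η + S.ε) * V + 10.5 * X := by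
    intro Φ hΦ0 hΦ V hV
    have h1 := mul_le_mul_of_nonneg_right hρ hV
    have h2 : P.L * S.b * Φ ≤ P.L * S.b * (S.errorLevel + S.c / S.b) :=
      mul_le_mul_of_nonneg_left hΦ h.LB_nonneg
    have h3 : P.L * S.b * (S.errorLevel + S.c / S.b) =
        5 * ((η + S.ε) * (S.α * (S.c * P.L))) + S.c * P.L := by
      unfold errorLevel
      field_simp
    -- `31 / 15 = 16 / 15 + 1`. The error level then contributes `31 / 3 * X` and the overshoot at
    -- most `31 / 240 * X`, in total below `10.5 * X`.
    have h4 : S.ratio + 1 ≤ 31 / 15 * γ := by linarith [h.ratio_le]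
    have h5 := mul_le_mul h4 (h2.trans_eq h3) (mul_nonneg h.LB_nonneg hΦ0) (by positivity)
    have h6 : 31 / 15 * γ * (5 * ((η + S.ε) * (S.α * (S.c * P.L))) + S.c * P.L) =
        31 / 3 * X + 31 / 15 * (γ * (S.c * P.L)) := by
      rw [hX]
      ring
    nlinarith
  rcases h.costToGo_predictive_le hN hagree a hσ plan y with
    ⟨h1, h2⟩ | ⟨s, h1, h2, -, h4, p', y', h5⟩
  · have h3 := herr _ (h.errorSum_nonneg σ N) h2 _ (P.val_nonneg σ N e a)
    linarith
  · have h3 := herr _ (h.errorSum_nonneg σ (s + 1)) h4 _ (P.val_nonneg σ (s + 1 : ℕ) e a)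
    have h6 := hcons (s + 1) (by omega) (by omega) p' y'
    have h7 := mul_le_mul_of_nonneg_left (h.overhead_le (s + 1)) (by linarith : 0 ≤ η + S.ε)
    rw [← P.val_add (by omega : σ ≤ s + 1) (by omega : s + 1 ≤ N) e a]
    linarith

theorem costToGo_le_mul (hρ : S.ratio ≤ η + S.ε) {τ : ℕ} (hτ : τ ≤ N) (plan x : ∀ i, A i) :
    S.costToGo e (N - τ) τ (Mode.conservative τ, plan, x) ≤
      (η + S.ε) * (P.val τ N e a + overhead S τ) := by
  induction hd : N - τ using Nat.strong_induction_on generalizing τ plan x with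
  | _ d ih =>
  subst hd
  refine h.costToGo_conservative_le_mul a hτ (fun σ hσ hσN plan' y => ?_) plan x
  exact h.costToGo_predictive_le_mul hN hagree a hρ hσN
    (fun τ' h1 h2 plan'' x' => ih (N - τ') (by omega) h2 plan'' x' rfl) plan' y

end Competitive

/-! ### The bound with an additive error term. -/

section Additive

/-- The additive loss per unit of prediction error. -/
noncomputable def errorRate (S : Input P γ η f) : ℝ :=
  (4 * η + 3 * S.ε) * γ * (P.L * S.b) / S.ε

theorem errorRate_eq : errorRate S = (4 * (η / S.ε) + 3) * γ * (P.L * S.b) := by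
  have := h.ε_pos
  unfold errorRate
  field_simp

theorem errorRate_nonneg : 0 ≤ errorRate S := by
  have := h.ε_pos
  have := h.one_le_η
  have := h.one_le_γ
  have := h.LB_nonneg
  unfold errorRate
  positivity

theorem costToGo_conservative_le_add (hcL : 1 ≤ S.c * P.L) {τ : ℕ} (hτ : τ ≤ N)
    (hpred : ∀ σ, τ ≤ σ → σ ≤ N → ∀ plan y, S.costToGo e (N - σ) σ
      (Mode.predictive σ σ, plan, y) ≤
        S.ratio * P.val σ N e a + errorRate S * S.errorSum e σ N + γ * (S.c * P.L))
    (plan x : ∀ i, A i) :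
    S.costToGo e (N - τ) τ (Mode.conservative τ, plan, x) ≤
      S.ratio * P.val τ N e a + errorRate S * S.errorSum e τ N + 19 * scale S := by
  have hη := h.one_le_η
  have hγ := h.one_le_γ
  have hρ : 0 ≤ S.ratio := by linarith [h.γ_le_ratio]
  have hκ := h.errorRate_nonneg
  have hscale := h.unit_le_scale
  have hscaleL := h.L_le_scale
  have hL := h.L_pos
  have hunit := h.unit_pos
  have hV := mul_nonneg hρ (P.val_nonneg τ N e a)
  have hΦ := mul_nonneg hκ (h.errorSum_nonneg τ N)
  have key := stoppedPhase_le_add (K := N - τ)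
    (U := fun k => S.onlineMean e τ x k + S.phaseValue e τ plan x (N - τ - k) k)
    (μ := S.onlineMean e τ x)
    (h := fun k => S.exitValue e τ plan x (N - (τ + k)) k)
    (p := fun k => S.switchProb e τ (τ + k) x) (L := P.L) (Θ := 18.5 * scale S)
    (W := S.ratio * P.val τ N e a + errorRate S * S.errorSum e τ N + γ * (S.c * P.L))
    (phaseValue_recursion plan x) (by simp [phaseValue, costToGo])
    (fun k => S.switchProb_nonneg e _ _ _) (fun k => S.switchProb_le_one e _ _ _) hL.le
    (by linarith) (S.onlineMean_le_succ e τ x) (S.onlineMean_succ_le e τ x)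
    (fun k hk => ?_) (fun k hk hhigh => ?_)
  · simp only [onlineMean_zero, zero_add, Nat.sub_zero, phaseValue_zero] at key
    -- The additive terms are `18.5 * scale`, `2 * L ≤ scale / 8` and `γ * c * L ≤ scale / 16`,
    -- together below `19 * scale`.
    rw [max_eq_left (by linarith)] at key
    linarith
  · refine S.exitValue_le e τ plan x _ k fun y => (hpred (τ + k) (by omega) (by omega) plan y).trans
      ?_
    have h1 := P.val_add (Nat.le_add_right τ k) (by omega : τ + k ≤ N) e a
    have h2 : S.errorSum e τ (τ + k) + S.errorSum e (τ + k) N = S.errorSum e τ N :=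
      errorSum_add (Nat.le_add_right τ k) (by omega)
    have h3 : P.val (τ + k) N e a ≤ P.val τ N e a := by
      linarith [P.val_nonneg τ (τ + k : ℕ) e a]
    have h4 : S.errorSum e (τ + k) N ≤ S.errorSum e τ N := by
      linarith [h.errorSum_nonneg τ (τ + k)]
    linarith [mul_le_mul_of_nonneg_left h3 hρ, mul_le_mul_of_nonneg_left h4 hκ]
  -- The second test cannot block the exit here: with an optimum below `γ`, the online cost would be
  -- at most `η * (γ + c * L) ≤ 2 * η * γ * c * L`, far below the threshold. The last inequality
  -- uses `1 ≤ c * L`.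
  · have hopt : γ ≤ S.optEstimate e τ (τ + k) x := by
      by_contra hlt
      have h1 : S.onlineMean e τ x (k + 1) ≤ η * (P.opt τ (τ + (k + 1) : ℕ) e x + S.c * P.L) := by
        have hlt : τ < τ + (k + 1) := by omega
        rw [onlineMean, ← PolicyClass.val_eq_integral]
        rcases Nat.eq_zero_or_pos τ with rfl | hτ
        · refine (S.online.le_zero _ e x (by exact_mod_cast hlt) h.finite_e).trans
            (mul_le_mul_of_nonneg_left (by linarith) (by linarith))
        · refine (S.online.le_pos τ _ e x hτ (by exact_mod_cast hlt) h.finite_e).trans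
            (mul_le_mul_of_nonneg_left (by linarith [h.influence_le]) (by linarith))
      have h2 : P.opt τ (τ + (k + 1) : ℕ) e x ≤ S.optEstimate e τ (τ + k) x :=
        P.opt_le_val _ _ _ _ _
      have h3 : γ + S.c * P.L ≤ 2 * (γ * (S.c * P.L)) := by nlinarith
      have h4 : η * (P.opt τ (τ + (k + 1) : ℕ) e x + S.c * P.L) ≤
          η * (2 * (γ * (S.c * P.L))) :=
        mul_le_mul_of_nonneg_left (by linarith [not_le.1 hlt]) (by linarith)
      linarith [h.le_scale]
    have hZ : 0 < scale S := by linarith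
    refine (h.one_sub_switchProb_le τ k x (δ := scale S / 2) (by positivity)
      (by rw [threshold_eq]; linarith) hopt).trans ?_
    have h1 := S.onlineMean_le_mul e τ x (k + 1)
    have hk0 : (0 : ℝ) ≤ k := Nat.cast_nonneg k
    have h2 : (k : ℝ) + 1 ≤ ((k : ℝ) + 1) ^ 4 := le_self_pow₀ (by linarith) (by norm_num)
    rw [div_le_iff₀ (by positivity)]
    push_cast at h1
    have h3 : P.L ^ 2 ≤ (scale S / 2) ^ 2 / 2 := by nlinarith
    calc P.L * S.onlineMean e τ x (k + 1) ≤ P.L * (((k : ℝ) + 1) * P.L) := by gcongr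
      _ = ((k : ℝ) + 1) * P.L ^ 2 := by ring
      _ ≤ ((k : ℝ) + 1) ^ 4 * ((scale S / 2) ^ 2 / 2) := by gcongr
      _ = _ := by ring

include hN hagree

/-- The error accumulated before a switch pays for the cut batch and for the whole additive term of
the conservative phase that follows, so these terms do not pile up over the phases. -/
theorem costToGo_predictive_le_add {σ : ℕ} (hσ : σ ≤ N)
    (hcons : ∀ τ, σ < τ → τ ≤ N → ∀ plan x, S.costToGo e (N - τ) τ
      (Mode.conservative τ, plan, x) ≤
        S.ratio * P.val τ N e a + errorRate S * S.errorSum e τ N + 19 * scale S)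
    (plan y : ∀ i, A i) :
    S.costToGo e (N - σ) σ (Mode.predictive σ σ, plan, y) ≤
      S.ratio * P.val σ N e a + errorRate S * S.errorSum e σ N + γ * (S.c * P.L) := by
  have hη := h.one_le_η
  have hε := h.ε_pos
  have hγ := h.one_le_γ
  have hLB := h.LB_nonneg
  have hunit := h.unit_le
  have hunit0 := h.unit_pos
  have hb0 : 0 < S.b := by linarith [h.one_le_b]
  have hrate := h.errorRate_eq
  have hηε : 0 ≤ η / S.ε := by positivity
  -- The `3` in the error rate splits as `31 / 15 + 14 / 15`: the first share covers the direct
  -- effect of the error, and the second, with `4 * η / ε`, is saved for the switch.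
  have hgap : ∀ Φ, 0 ≤ Φ → (S.ratio + 1) * (P.L * S.b * Φ) +
      (4 * (η / S.ε) + 14 / 15) * γ * (P.L * S.b * Φ) ≤ errorRate S * Φ := by
    intro Φ hΦ
    have h1 : S.ratio + 1 ≤ 31 / 15 * γ := by linarith [h.ratio_le]
    have h2 := mul_le_mul_of_nonneg_right h1 (mul_nonneg hLB hΦ)
    rw [hrate]
    linarith
  rcases h.costToGo_predictive_le hN hagree a hσ plan y with
    ⟨h1, -⟩ | ⟨s, h1, h2, h3, -, p', y', h5⟩
  · have h2 := hgap _ (h.errorSum_nonneg σ N)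
    have h3 : 0 ≤ (4 * (η / S.ε) + 14 / 15) * γ * (P.L * S.b * S.errorSum e σ N) :=
      mul_nonneg (by positivity) (mul_nonneg hLB (h.errorSum_nonneg σ N))
    linarith
  · have h4 := hgap _ (h.errorSum_nonneg σ (s + 1))
    have h6 := hcons (s + 1) (by omega) (by omega) p' y'
    have h7 : P.L * S.b * S.errorLevel ≤ P.L * S.b * S.errorSum e σ (s + 1) :=
      mul_le_mul_of_nonneg_left h3 hLB
    have h8 : P.L * S.b * S.errorLevel = 5 * ((η + S.ε) * (S.α * (S.c * P.L))) := by
      unfold errorLevel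
      field_simp
    rw [h8] at h7
    have h9 := mul_le_mul_of_nonneg_left h7
      (by positivity : 0 ≤ (4 * (η / S.ε) + 14 / 15) * γ)
    -- The saved share at the error level: `20 * scale` covers the next `19 * scale` with room to
    -- spare, and the other term covers the cut batch.
    have h10 : (4 * (η / S.ε) + 14 / 15) * γ * (5 * ((η + S.ε) * (S.α * (S.c * P.L)))) =
        20 * scale S + 14 / 3 * ((η + S.ε) * (γ * S.α * (S.c * P.L))) := by
      unfold scale
      ring
    have h11 : γ * S.α * (S.c * P.L) ≤ (η + S.ε) * (γ * S.α * (S.c * P.L)) :=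
      le_mul_of_one_le_left (by linarith) (by linarith)
    have h12 := h.unit_le_scale
    have h13 : S.errorSum e σ (s + 1) + S.errorSum e (s + 1) N = S.errorSum e σ N :=
      errorSum_add (by omega) (by omega)
    rw [← P.val_add (by omega : σ ≤ s + 1) (by omega : s + 1 ≤ N) e a, ← h13]
    linarith

theorem costToGo_le_add (hcL : 1 ≤ S.c * P.L) {τ : ℕ} (hτ : τ ≤ N) (plan x : ∀ i, A i) :
    S.costToGo e (N - τ) τ (Mode.conservative τ, plan, x) ≤
      S.ratio * P.val τ N e a + errorRate S * S.errorSum e τ N + 19 * scale S := by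
  induction hd : N - τ using Nat.strong_induction_on generalizing τ plan x with
  | _ d ih =>
  subst hd
  refine h.costToGo_conservative_le_add a hcL hτ (fun σ hσ hσN plan' y => ?_) plan x
  exact h.costToGo_predictive_le_add hN hagree a hσN
    (fun τ' h1 h2 plan'' x' => ih (N - τ') (by omega) h2 plan'' x' rfl) plan' y

end Additive

end Input.Admissible

/-! ### Choice of the horizon and passage to the optimum. -/

namespace CostProblem

variable (P : CostProblem E A) [∀ t, Nonempty (A t)]

theorem totalOpt_nonneg (e : ∀ i, E i) : 0 ≤ P.totalOpt e :=
  le_ciInf fun a => P.val_nonneg 0 ⊤ e a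

theorem L_pos_of_totalOpt_ne_zero {e : ∀ i, E i} (h : P.totalOpt e ≠ 0) : 0 < P.L := by
  by_contra hL
  refine h ?_
  have h0 : ∀ t (a : ∀ i, A i), P.costAt t e a = 0 := fun t a =>
    le_antisymm ((P.costAt_le t e a).trans (not_lt.1 hL)) (P.costAt_nonneg t e a)
  simp [totalOpt, val, h0]

end CostProblem

theorem exists_horizon {P : CostProblem E A} {e e' : ∀ i, E i} (he : P.IsFinite e)
    (hdiff : {i | e i ≠ e' i}.Finite) :
    ∃ N : ℕ, P.effLen e ≤ N ∧ ∀ i, N ≤ i → e i = e' i := by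
  obtain ⟨M, hM⟩ := ENat.ne_top_iff_exists.1 he.effLen_lt.ne
  obtain ⟨K, hK⟩ := hdiff.bddAbove
  refine ⟨max M (K + 1), ?_, fun i hi => ?_⟩
  · rw [← hM]
    exact_mod_cast le_max_left _ _
  · by_contra hne
    have := hK hne
    omega

variable [∀ t, MetricSpace (E t)]

namespace Input

variable {P : CostProblem E A} {γ η f : ℝ} {S : Input P γ η f} {e : ∀ i, E i} {u v : ℝ}

namespace Admissible

variable (h : S.Admissible e u v) {N : ℕ} (hN : P.effLen e ≤ N)
  (hagree : ∀ i, N ≤ i → e i = S.eStar i)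

include h hagree

theorem totalError_eq : S.totalError e = S.errorSum e 0 N := by
  rw [totalError, errorSum, tsum_eq_sum (s := Finset.Ico 0 N)]
  intro i hi
  rw [hagree i (by simpa using hi), dist_self]
  exact min_eq_left (div_nonneg (by linarith [h.one_le_c]) (by linarith [h.one_le_b]))

theorem totalError_le : S.totalError e ≤ ∑' i, dist (e i) (S.eStar i) := by
  rw [h.totalError_eq hagree, errorSum, tsum_eq_sum (s := Finset.Ico 0 N)]
  · exact Finset.sum_le_sum fun i _ => min_le_left _ _
  · intro i hi
    rw [hagree i (by simpa using hi), dist_self]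

variable [∀ t, Nonempty (A t)]

omit hagree [∀ t, MetricSpace (E t)] h in
/-- A guarantee relative to every action sequence is a guarantee relative to the optimum. -/
theorem le_mul_totalOpt_add {C r B : ℝ} (hr : 0 < r)
    (hC : ∀ a : ∀ i, A i, C ≤ r * P.val 0 ⊤ e a + B) : C ≤ r * P.totalOpt e + B := by
  have h1 : (C - B) / r ≤ P.totalOpt e := by
    refine le_ciInf fun a => ?_
    rw [div_le_iff₀ hr]
    linarith [hC a]
  rw [div_le_iff₀ hr] at h1
  linarith

include hN

theorem comp_le_of_ratio_le (hopt : 0 < P.totalOpt e) (hρ : S.ratio ≤ η + S.ε) :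
    S.comp e ≤ η + S.ε := by
  rw [comp, div_le_iff₀ hopt]
  have := le_mul_totalOpt_add (P := P) (e := e) (C := S.expectedCost e) (r := η + S.ε) (B := 0)
    (by linarith [h.one_le_η, h.ε_pos]) fun a => ?_
  · linarith
  · rw [S.expectedCost_eq_costToGo e hN, CostProblem.val_top_eq_of_effLen_le hN]
    have h1 := h.costToGo_le_mul hN hagree a hρ (Nat.zero_le N)
      (fun _ => Classical.arbitrary _) fun _ => Classical.arbitrary _
    simpa [overhead] using h1

theorem comp_le_of_one_le (hopt : 0 < P.totalOpt e) (hcL : 1 ≤ S.c * P.L) :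
    S.comp e ≤ S.ratio + P.L / (S.ε * P.totalOpt e) *
      (19 * γ * S.α * η * (η + S.ε) * S.c + (4 * η + 3 * S.ε) * γ * S.b * S.totalError e) := by
  have hε := h.ε_pos
  have h1 := le_mul_totalOpt_add (P := P) (e := e) (C := S.expectedCost e) (r := S.ratio)
    (B := errorRate S * S.errorSum e 0 N + 19 * scale S)
    (by linarith [h.one_le_γ, h.γ_le_ratio]) fun a => ?_
  · rw [comp, div_le_iff₀ hopt, h.totalError_eq hagree]
    refine h1.trans_eq ?_
    unfold errorRate scale
    field_simp
    ring
  · rw [S.expectedCost_eq_costToGo e hN, CostProblem.val_top_eq_of_effLen_le hN, ← add_assoc]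
    exact h.costToGo_le_add hN hagree a hcL (Nat.zero_le N)
      (fun _ => Classical.arbitrary _) fun _ => Classical.arbitrary _

end Admissible

end Input

end AdaSwitch

theorem mainTheorem4 {E A : ℕ → Type*} [∀ t, MetricSpace (E t)] [∀ t, MeasurableSpace (A t)]
    [∀ t, Nonempty (A t)] (P : AdaSwitch.CostProblem E A) (u v f γ η : ℝ)
    (hLip : P.StronglyLipschitz u v) (hInf : P.BoundedInfluence f) (hγ : 1 ≤ γ) (hη : 1 ≤ η)
    (S : AdaSwitch.Input P γ η f) (hε : 0 < S.ε) (hb : S.b = u) (hc : S.c = max v f)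
    (hα : max (16 * γ) (γ + 2 * γ ^ 2 / S.ε) ≤ S.α) (hb1 : 1 ≤ S.b) (hbc : S.b ≤ S.c)
    (hH : 1 ≤ S.H) (hStar : P.IsFinite S.eStar) (e : ∀ i, E i) (he : P.IsFinite e)
    (hnontrivial : P.totalOpt e ≠ 0) (hdiff : {i | e i ≠ S.eStar i}.Finite) :
    (γ + γ ^ 2 / (S.α - γ) ≤ η + S.ε → S.comp e ≤ η + S.ε) ∧
    (1 ≤ S.c * P.L → S.comp e ≤ γ + γ ^ 2 / (S.α - γ) + P.L / (S.ε * P.totalOpt e) *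
      (19 * γ * S.α * η * (η + S.ε) * S.c + (4 * η + 3 * S.ε) * γ * S.b * S.totalError e)) ∧
    S.totalError e ≤ ∑' i, dist (e i) (S.eStar i) := by
  have hopt : 0 < P.totalOpt e := lt_of_le_of_ne (P.totalOpt_nonneg e) hnontrivial.symm
  have h : S.Admissible e u v :=
    ⟨hLip, hInf, hγ, hη, hε, hb, hc, (le_max_left _ _).trans hα, hb1, hbc, hH, hStar, he,
      P.L_pos_of_totalOpt_ne_zero hnontrivial⟩
  obtain ⟨N, hN, hagree⟩ := AdaSwitch.exists_horizon he hdiff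
  exact ⟨fun hρ => h.comp_le_of_ratio_le hN hagree hopt hρ,
    fun hcL => h.comp_le_of_one_le hN hagree hopt hcL, h.totalError_le hagree⟩
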